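/- Let $d\in\mathbf N$ and $t\ge s>1$. For multi-indices write $|\alpha|=\alpha_1+\dots+\alpha_d$, $\alpha!=\alpha_1!\cdots\alpha_d!$. Let $\Sigma_t^s(\mathbf R^d)$ be the space of all $f\in C^\infty(\mathbf R^d)$ such that for every $h>0$ $$\|f\|_h=\sup_{\alpha,\beta\in\mathbf N^d,\ x\in\mathbf R^d}\frac{|x^\alpha D^\beta f(x)|}{h^{|\alpha+\beta|}\,\alpha!^{t}\,\beta!^{s}}<\infty ,$$ with the Fréchet space topology defined by the norms $\|\cdot\|_h$, $h>0$, and let $(\Sigma_t^s)'(\mathbf R^d)$ be its topological dual; $\langle u,f\rangle$ denotes the bilinear pairing. For $\psi\in\Sigma_t^s(\mathbf R^d)\setminus 0$ and $u\in(\Sigma_t^s)'(\mathbf R^d)$ let $$V_\psi u(x,\xi)=(2\pi)^{-d/2}\,\big\langle u,\ \overline{\psi(\cdot-x)}\,e^{-i\langle\cdot,\xi\rangle}\big\rangle,\qquad x,\xi\in\mathbf R^d .$$ The set $\mathrm{WF}^{t,s}(u)\subseteq\mathbf R^{2d}\setminus 0$ is defined as follows: $(x_0,\xi_0)\in\mathbf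 R^{2d}\setminus0$ satisfies $(x_0,\xi_0)\notin\mathrm{WF}^{t,s}(u)$ if there is an open set $U\subseteq\mathbf R^{2d}\setminus 0$ containing $(x_0,\xi_0)$ such that $$\sup_{\lambda>0,\ (x,\xi)\in U}e^{r\lambda}\,|V_\psi u(\lambda^t x,\lambda^s\xi)|<\infty\qquad\text{for all } r>0 .$$ Let $G_c^s(\mathbf R^d)$ be the space of compactly supported $\varphi\in C^\infty(\mathbf R^d)$ such that for every $h>0$ there is $C>0$ with $|\partial^\alpha\varphi(x)|\le C\,h^{|\alpha|}\alpha!^s$ for all $x\in\mathbf R^d$, $\alpha\in\mathbf N^d$. Then $G_c^s(\mathbf R^d)\subseteq\Sigma_t^s(\mathbf R^d)$, and by restriction to $G_c^s(\mathbf R^d)$ each $u\in(\Sigma_t^s)'(\mathbf R^d)$ is a Gevrey ultradistribution of order $s$. For $\varphi\in G_c^s(\mathbf R^d)$ let $\widehat{u\varphi}(\xi)=(2\pi)^{-d/2}\langle u,\varphi\, e^{-i\langle\cdot,\xi\rangle}\rangle$. The Gevrey wave front set $\mathrm{WF}_s(u)\subseteq\mathbf R^d\times(\mathbf R^d\setminus0)$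 is defined as follows: $(x_0,\xi_0)\in\mathbf R^d\times(\mathbf R^d\setminus0)$ satisfies $(x_0,\xi_0)\notin\mathrm{WF}_s(u)$ if there are $\varphi\in G_c^s(\mathbf R^d)$ with $\varphi(x_0)=1$ and an open conic set $\Gamma\subseteq\mathbf R^d\setminus 0$ containing $\xi_0$ such that $$\sup_{\xi\in\Gamma}e^{r|\xi|^{1/s}}\,|\widehat{u\varphi}(\xi)|<\infty\qquad\text{for all } r>0 .$$ Finally let $\pi_2(x,\xi)=\xi$. Then for every $u\in(\Sigma_t^s)'(\mathbf R^d)$, $$\{0\}\times\pi_2\,\mathrm{WF}_s(u)\subseteq\mathrm{WF}^{t,s}(u),$$ whichever window $\psi\in\Sigma_t^s(\mathbf R^d)\setminus 0$ is used to define $\mathrm{WF}^{t,s}(u)$. -/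

import Mathlib

open scoped ContDiff Nat

namespace GelfandShilovWF

/-- The Euclidean space `ℝ^d`. -/
abbrev E (d : ℕ) : Type := EuclideanSpace ℝ (Fin d)

/-- The partial derivative `∂_j f`. -/
noncomputable def pderiv {d : ℕ} (j : Fin d) (f : E d → ℂ) : E d → ℂ :=
  fun x => fderiv ℝ f x (EuclideanSpace.single j 1)

/-- The partial derivative `∂^β f = ∂_0^{β_0} ⋯ ∂_{d-1}^{β_{d-1}} f` of a multi-index `β ∈ ℕ^d`. -/
noncomputable def mderiv {d : ℕ} (β : Fin d → ℕ) (f : E d → ℂ) : E d → ℂ :=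
  (List.finRange d).foldr (fun j g => (pderiv j)^[β j] g) f

/-- The length `|α| = α_0 + ⋯ + α_{d-1}`. -/
def mlen {d : ℕ} (α : Fin d → ℕ) : ℕ := ∑ j, α j

/-- The factorial `α! = α_0! ⋯ α_{d-1}!`. -/
def mfact {d : ℕ} (α : Fin d → ℕ) : ℕ := ∏ j, (α j)!

/-- The monomial `x^α`. -/
noncomputable def mpow {d : ℕ} (x : E d) (α : Fin d → ℕ) : ℝ := ∏ j, x j ^ α j

/-! ### Multi-indices and iterated Fréchet derivatives -/

/-- The list of directions of differentiation in `∂^β`. -/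
def dirs {d : ℕ} (β : Fin d → ℕ) : List (Fin d) :=
  (List.finRange d).flatMap (fun j => List.replicate (β j) j)

theorem mderiv_eq_foldr {d : ℕ} (β : Fin d → ℕ) (f : E d → ℂ) :
    mderiv β f = (dirs β).foldr pderiv f := by
  have key : ∀ l : List (Fin d), l.foldr (fun j g => (pderiv j)^[β j] g) f =
      (l.flatMap (fun j => List.replicate (β j) j)).foldr pderiv f := by
    intro l
    induction l with
    | nil => rfl
    | cons j l ih =>
      have h2 : ∀ (n : ℕ) (g : E d → ℂ),
          (List.replicate n j).foldr pderiv g = (pderiv j)^[n] g := by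
        intro n g
        induction n with
        | zero => rfl
        | succ n ih => rw [List.replicate_succ, List.foldr_cons, ih, Function.iterate_succ_apply']
      rw [List.foldr_cons, List.flatMap_cons, List.foldr_append, ← ih, h2]
  exact key _

theorem contDiff_pderiv {d : ℕ} (j : Fin d) {f : E d → ℂ} (hf : ContDiff ℝ ∞ f) :
    ContDiff ℝ ∞ (pderiv j f) :=
  (hf.fderiv_right (m := ∞) (by simp)).clm_apply contDiff_const

theorem contDiff_foldr {d : ℕ} (l : List (Fin d)) {f : E d → ℂ} (hf : ContDiff ℝ ∞ f) :
    ContDiff ℝ ∞ (l.foldr pderiv f) := by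
  induction l with
  | nil => exact hf
  | cons j l ih => exact contDiff_pderiv j ih

theorem contDiff_mderiv {d : ℕ} (β : Fin d → ℕ) {f : E d → ℂ} (hf : ContDiff ℝ ∞ f) :
    ContDiff ℝ ∞ (mderiv β f) := by
  rw [mderiv_eq_foldr]; exact contDiff_foldr _ hf

theorem pderiv_comm {d : ℕ} (i j : Fin d) {f : E d → ℂ} (hf : ContDiff ℝ ∞ f) :
    pderiv i (pderiv j f) = pderiv j (pderiv i f) := by
  have hd : Differentiable ℝ (fderiv ℝ f) :=
    (hf.fderiv_right (m := ∞) (by simp)).differentiable (by simp)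
  have h : ∀ (i j : Fin d) (x : E d), pderiv i (pderiv j f) x =
      fderiv ℝ (fderiv ℝ f) x (EuclideanSpace.single i 1) (EuclideanSpace.single j 1) := by
    intro i j x
    change fderiv ℝ (fun y => fderiv ℝ f y (EuclideanSpace.single j 1)) x _ = _
    rw [fderiv_clm_apply (hd x) (differentiableAt_const _)]
    simp
  funext x
  rw [h, h]
  have hs : IsSymmSndFDerivAt ℝ f x :=
    hf.contDiffAt.isSymmSndFDerivAt (by simpa using (WithTop.coe_le_coe.mpr (le_top : (2 : ℕ∞) ≤ ⊤) : (2 : WithTop ℕ∞) ≤ ∞))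
  exact hs _ _

theorem foldr_perm {d : ℕ} {l l' : List (Fin d)} (h : l.Perm l') {f : E d → ℂ}
    (hf : ContDiff ℝ ∞ f) : l.foldr pderiv f = l'.foldr pderiv f := by
  induction h with
  | nil => rfl
  | cons j _ ih => simp only [List.foldr_cons, ih]
  | swap i j l => exact pderiv_comm _ _ (contDiff_foldr l hf)
  | trans _ _ ih1 ih2 => exact ih1.trans ih2

theorem iteratedFDeriv_basis {d : ℕ} {f : E d → ℂ} (hf : ContDiff ℝ ∞ f) (n : ℕ)
    (j : Fin n → Fin d) (x : E d) :
    iteratedFDeriv ℝ n f x (fun i => EuclideanSpace.single (j i) (1 : ℝ)) =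
      (List.ofFn j).foldr pderiv f x := by
  induction n generalizing x with
  | zero => simp
  | succ n ih =>
    rw [iteratedFDeriv_succ_apply_left, List.ofFn_succ, List.foldr_cons]
    have h1 : (List.ofFn fun i : Fin n => j i.succ).foldr pderiv f =
        fun y => iteratedFDeriv ℝ n f y (fun i => EuclideanSpace.single (j i.succ) (1 : ℝ)) := by
      funext y; exact (ih (fun i => j i.succ) y).symm
    rw [h1]
    have hd : DifferentiableAt ℝ (iteratedFDeriv ℝ n f) x :=
      (hf.differentiable_iteratedFDeriv (by exact_mod_cast ENat.natCast_lt_top n)) x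
    change _ = fderiv ℝ (fun y => iteratedFDeriv ℝ n f y _) x (EuclideanSpace.single (j 0) 1)
    have := (hd.hasFDerivAt.continuousMultilinear_apply_const
      (fun i => EuclideanSpace.single (j i.succ) (1 : ℝ))).fderiv
    rw [this]
    rfl

theorem count_dirs {d : ℕ} (β : Fin d → ℕ) (j : Fin d) : (dirs β).count j = β j := by
  unfold dirs
  rw [List.count_flatMap]
  have : (List.map (List.count j ∘ fun k => List.replicate (β k) k) (List.finRange d)) =
      List.map (fun k => if k = j then β k else 0) (List.finRange d) := by
    apply List.map_congr_left
    intro k _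
    simp [List.count_replicate]
  rw [this, ← List.ofFn_eq_map, List.sum_ofFn]
  simp

theorem length_dirs {d : ℕ} (β : Fin d → ℕ) : (dirs β).length = mlen β := by
  unfold dirs mlen
  rw [List.length_flatMap]
  simp only [List.length_replicate]
  rw [← List.ofFn_eq_map, List.sum_ofFn]

theorem norm_mderiv_le {d : ℕ} {f : E d → ℂ} (hf : ContDiff ℝ ∞ f) (β : Fin d → ℕ) (x : E d) :
    ‖mderiv β f x‖ ≤ ‖iteratedFDeriv ℝ (mlen β) f x‖ := by
  have h := iteratedFDeriv_basis hf (dirs β).length (fun i => (dirs β).get i) x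
  rw [List.ofFn_get, ← mderiv_eq_foldr] at h
  rw [← h, ← length_dirs]
  refine (ContinuousMultilinearMap.le_opNorm _ _).trans ?_
  simp

theorem norm_iteratedFDeriv_le {d : ℕ} {f : E d → ℂ} (hf : ContDiff ℝ ∞ f) (n : ℕ) (x : E d)
    {B : ℝ} (hB0 : 0 ≤ B) (hB : ∀ β : Fin d → ℕ, mlen β = n → ‖mderiv β f x‖ ≤ B) :
    ‖iteratedFDeriv ℝ n f x‖ ≤ (d : ℝ) ^ n * B := by
  refine ContinuousMultilinearMap.opNorm_le_bound (by positivity) ?_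
  intro m
  have hm : m = fun i => ∑ k : Fin d, (m i k) • (EuclideanSpace.single k (1 : ℝ) : E d) := by
    funext i
    ext k
    simp [Finset.sum_apply, Pi.single_apply]
  have hbound : ∀ j : Fin n → Fin d,
      ‖iteratedFDeriv ℝ n f x (fun i => (m i (j i)) • (EuclideanSpace.single (j i) (1 : ℝ) : E d))‖
        ≤ (∏ i, ‖m i‖) * B := by
    intro j
    rw [ContinuousMultilinearMap.map_smul_univ, norm_smul, norm_prod]
    refine mul_le_mul ?_ ?_ (norm_nonneg _) (by positivity)
    · exact Finset.prod_le_prod (fun _ _ => norm_nonneg _) fun i _ => PiLp.norm_apply_le _ _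
    · rw [iteratedFDeriv_basis hf]
      have hp : (List.ofFn j).Perm (dirs fun k => (List.ofFn j).count k) := by
        rw [List.perm_iff_count]
        intro k
        rw [count_dirs]
      rw [foldr_perm hp hf, ← mderiv_eq_foldr]
      apply hB
      rw [← length_dirs, ← hp.length_eq, List.length_ofFn]
  calc ‖iteratedFDeriv ℝ n f x m‖
      = ‖∑ j : Fin n → Fin d, iteratedFDeriv ℝ n f x
          (fun i => (m i (j i)) • (EuclideanSpace.single (j i) (1 : ℝ) : E d))‖ := by
        conv_lhs => rw [hm]
        rw [ContinuousMultilinearMap.map_sum]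
    _ ≤ ∑ j : Fin n → Fin d, (∏ i, ‖m i‖) * B :=
        norm_sum_le_of_le _ fun j _ => hbound j
    _ = (d : ℝ) ^ n * B * ∏ i, ‖m i‖ := by
        simp; ring


/-! ### Elementary estimates -/

theorem exists_pow_le {t : ℝ} (ht : 0 < t) (R : ℝ) (hR : 0 ≤ R) {k : ℝ} (hk : 0 < k) :
    ∃ C : ℝ, 1 ≤ C ∧ ∀ n : ℕ, R ^ n ≤ C * (k ^ n * (n ! : ℝ) ^ t) := by
  refine ⟨Real.exp ((R / k) ^ (1 / t)) ^ t, Real.one_le_rpow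
    (Real.one_le_exp (by positivity)) ht.le, fun n => ?_⟩
  have h1 := Real.pow_div_factorial_le_exp (x := (R / k) ^ (1 / t)) (by positivity) n
  have h2 : (((R / k) ^ (1 / t)) ^ n / (n ! : ℝ)) ^ t ≤ Real.exp ((R / k) ^ (1 / t)) ^ t :=
    Real.rpow_le_rpow (by positivity) h1 ht.le
  rw [Real.div_rpow (by positivity) (by positivity), ← Real.rpow_natCast, ← Real.rpow_mul
    (by positivity), ← Real.rpow_mul (by positivity)] at h2
  have h3 : 1 / t * ((n : ℝ) * t) = n := by field_simp
  rw [h3, Real.rpow_natCast, div_pow, div_le_iff₀ (by positivity),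
    div_le_iff₀ (by positivity)] at h2
  linarith

theorem mfact_pos {d : ℕ} (α : Fin d → ℕ) : (0 : ℝ) < mfact α := by
  unfold mfact
  exact_mod_cast Finset.prod_pos fun j _ => Nat.factorial_pos _

theorem mfact_le {d : ℕ} (α : Fin d → ℕ) : (mfact α : ℝ) ≤ ((mlen α)! : ℝ) := by
  unfold mfact mlen
  exact_mod_cast Nat.le_of_dvd (Nat.factorial_pos _) (Nat.prod_factorial_dvd_factorial_sum _ _)

theorem factorial_mlen_le {d : ℕ} (α : Fin d → ℕ) :
    ((mlen α)! : ℝ) ≤ ((d : ℝ) + 1) ^ mlen α * mfact α := by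
  have h1 := Nat.multinomial_spec Finset.univ α
  have h2 : Nat.multinomial Finset.univ α ≤ d ^ mlen α := by
    have h := Finset.sum_pow_eq_sum_piAntidiag (R := ℕ) (Finset.univ : Finset (Fin d))
      (fun _ => 1) (mlen α)
    simp only [Finset.sum_const, Finset.card_univ, Fintype.card_fin, smul_eq_mul, mul_one,
      one_pow, Finset.prod_const_one] at h
    rw [h]
    refine Finset.single_le_sum (f := fun k => Nat.multinomial Finset.univ k)
      (fun _ _ => Nat.zero_le _) ?_
    simp [mlen]
  have h3 : (mlen α)! ≤ (d + 1) ^ mlen α * mfact α := by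
    unfold mlen mfact at *
    rw [← h1, mul_comm]
    exact Nat.mul_le_mul_right _ (h2.trans (Nat.pow_le_pow_left (Nat.le_succ d) _))
  exact_mod_cast h3

theorem norm_le_of_multi {d : ℕ} {s : ℝ} (hs : 0 ≤ s) {f : E d → ℂ} (hf : ContDiff ℝ ∞ f)
    {W A k : ℝ} (hW : 0 ≤ W) (hA : 0 ≤ A) (hk : 0 < k) {x : E d}
    (h : ∀ β, W * ‖mderiv β f x‖ ≤ A * (k ^ mlen β * (mfact β : ℝ) ^ s)) (n : ℕ) :
    W * ‖iteratedFDeriv ℝ n f x‖ ≤ A * ((((d : ℝ) + 1) * k) ^ n * (n ! : ℝ) ^ s) := by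
  rcases hW.eq_or_lt with rfl | hW
  · rw [zero_mul]; positivity
  have h1 := norm_iteratedFDeriv_le hf n x (B := A * (k ^ n * (n ! : ℝ) ^ s) / W)
    (by positivity) (by
      intro β hβ
      rw [le_div_iff₀ hW, mul_comm]
      refine (h β).trans ?_
      rw [hβ]
      gcongr
      rw [← hβ]; exact_mod_cast mfact_le β)
  have h2 : W * ‖iteratedFDeriv ℝ n f x‖ ≤ (d : ℝ) ^ n * (A * (k ^ n * (n ! : ℝ) ^ s)) := by
    calc W * ‖iteratedFDeriv ℝ n f x‖
        ≤ W * ((d : ℝ) ^ n * (A * (k ^ n * (n ! : ℝ) ^ s) / W)) := by gcongr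
      _ = _ := by field_simp
  refine h2.trans ?_
  rw [mul_pow]
  have : (d : ℝ) ^ n ≤ ((d : ℝ) + 1) ^ n := by gcongr; linarith
  calc (d : ℝ) ^ n * (A * (k ^ n * (n ! : ℝ) ^ s))
      ≤ ((d : ℝ) + 1) ^ n * (A * (k ^ n * (n ! : ℝ) ^ s)) := by gcongr
    _ = _ := by ring

theorem multi_le_of_norm {d : ℕ} {s : ℝ} (hs : 0 ≤ s) {f : E d → ℂ} (hf : ContDiff ℝ ∞ f)
    {W A k : ℝ} (hW : 0 ≤ W) (hA : 0 ≤ A) (hk : 0 < k) {x : E d}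
    (h : ∀ n, W * ‖iteratedFDeriv ℝ n f x‖ ≤ A * (k ^ n * (n ! : ℝ) ^ s)) (β : Fin d → ℕ) :
    W * ‖mderiv β f x‖ ≤ A * ((((d : ℝ) + 1) ^ s * k) ^ mlen β * (mfact β : ℝ) ^ s) := by
  calc W * ‖mderiv β f x‖ ≤ W * ‖iteratedFDeriv ℝ (mlen β) f x‖ := by
        gcongr; exact norm_mderiv_le hf β x
    _ ≤ A * (k ^ mlen β * ((mlen β)! : ℝ) ^ s) := h _
    _ ≤ A * (k ^ mlen β * (((d : ℝ) + 1) ^ mlen β * mfact β) ^ s) := by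
        gcongr; exact factorial_mlen_le β
    _ = _ := by
        rw [Real.mul_rpow (by positivity) (mfact_pos β).le, mul_pow,
          ← Real.rpow_natCast (((d : ℝ) + 1) ^ s), ← Real.rpow_natCast ((d : ℝ) + 1),
          ← Real.rpow_mul (by positivity), ← Real.rpow_mul (by positivity), mul_comm s]
        ring

/-! ### Modulation, translation and complex conjugation of functions -/

/-- Modulation `M_ξ f(y) = e^{i⟨y, ξ⟩} f(y)`. -/
noncomputable def modFun {d : ℕ} (ξ : E d) (f : E d → ℂ) : E d → ℂ :=
  fun y => Complex.exp (Complex.I * ((inner ℝ y ξ : ℝ) : ℂ)) * f y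

/-- Translation `T_a f(y) = f(y - a)`. -/
def transFun {d : ℕ} (a : E d) (f : E d → ℂ) : E d → ℂ := fun y => f (y - a)

/-- Complex conjugation of a function. -/
noncomputable def conjFun {d : ℕ} (f : E d → ℂ) : E d → ℂ := fun y => starRingEnd ℂ (f y)

theorem contDiff_character {d : ℕ} (ξ : E d) :
    ContDiff ℝ ∞ (fun y : E d => Complex.exp (Complex.I * ((inner ℝ y ξ : ℝ) : ℂ))) := by
  have h : ContDiff ℝ ∞ (fun y : E d => ((inner ℝ y ξ : ℝ) : ℂ)) :=
    Complex.ofRealCLM.contDiff.comp (contDiff_id.inner ℝ contDiff_const)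
  exact (contDiff_const.mul h).cexp

theorem norm_iteratedFDeriv_character {d : ℕ} (ξ : E d) (n : ℕ) (x : E d) :
    ‖iteratedFDeriv ℝ n (fun y : E d => Complex.exp (Complex.I * ((inner ℝ y ξ : ℝ) : ℂ))) x‖
      ≤ ‖ξ‖ ^ n := by
  have hg : ContDiff ℝ ∞ (fun r : ℝ => Complex.exp (Complex.I * (r : ℂ))) :=
    (contDiff_const.mul Complex.ofRealCLM.contDiff).cexp
  have h1 : (fun y : E d => Complex.exp (Complex.I * ((inner ℝ y ξ : ℝ) : ℂ))) =
      (fun r : ℝ => Complex.exp (Complex.I * (r : ℂ))) ∘ (innerSL ℝ ξ) := by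
    funext y; simp [real_inner_comm]
  have h2 : ∀ n : ℕ, iteratedDeriv n (fun r : ℝ => Complex.exp (Complex.I * (r : ℂ))) =
      fun r : ℝ => Complex.I ^ n * Complex.exp (Complex.I * (r : ℂ)) := by
    intro n
    induction n with
    | zero => simp
    | succ n ih =>
      rw [iteratedDeriv_succ, ih]
      funext r
      have : HasDerivAt (fun r : ℝ => Complex.I ^ n * Complex.exp (Complex.I * (r : ℂ)))
          (Complex.I ^ n * (Complex.exp (Complex.I * (r : ℂ)) * (Complex.I * 1))) r :=
        (((Complex.ofRealCLM.hasDerivAt (x := r)).const_mul Complex.I).cexp).const_mul _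
      rw [this.deriv]
      ring
  rw [h1, ContinuousLinearMap.iteratedFDeriv_comp_right (innerSL ℝ ξ) hg x
    (i := n) (by exact_mod_cast le_top)]
  refine (ContinuousMultilinearMap.norm_compContinuousLinearMap_le _ _).trans ?_
  rw [norm_iteratedFDeriv_eq_norm_iteratedDeriv, h2]
  simp [Complex.norm_exp]

theorem contDiff_modFun {d : ℕ} (ξ : E d) {f : E d → ℂ} (hf : ContDiff ℝ ∞ f) :
    ContDiff ℝ ∞ (modFun ξ f) := (contDiff_character ξ).mul hf

theorem norm_modFun_le {d : ℕ} {s : ℝ} (hs : 0 < s) (ξ : E d) {k : ℝ} (hk : 0 < k) :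
    ∃ C' : ℝ, 1 ≤ C' ∧ ∀ f : E d → ℂ, ContDiff ℝ ∞ f → ∀ W A : ℝ, 0 ≤ W → 0 ≤ A → ∀ x : E d,
      (∀ n, W * ‖iteratedFDeriv ℝ n f x‖ ≤ A * (k ^ n * (n ! : ℝ) ^ s)) →
      ∀ n, W * ‖iteratedFDeriv ℝ n (modFun ξ f) x‖ ≤ C' * A * ((2 * k) ^ n * (n ! : ℝ) ^ s) := by
  obtain ⟨C', hC1, hC⟩ := exists_pow_le hs ‖ξ‖ (norm_nonneg _) hk
  refine ⟨C', hC1, fun f hf W A hW hA x h n => ?_⟩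
  have hC0 : 0 ≤ C' := by linarith
  have h1 := norm_iteratedFDeriv_mul_le (contDiff_character ξ) hf x (n := n)
    (by exact_mod_cast le_top)
  calc W * ‖iteratedFDeriv ℝ n (modFun ξ f) x‖
      ≤ W * ∑ i ∈ Finset.range (n + 1), (n.choose i : ℝ) *
        ‖iteratedFDeriv ℝ i (fun y : E d => Complex.exp (Complex.I * ((inner ℝ y ξ : ℝ) : ℂ))) x‖ *
        ‖iteratedFDeriv ℝ (n - i) f x‖ := mul_le_mul_of_nonneg_left h1 hW
    _ ≤ ∑ i ∈ Finset.range (n + 1), (n.choose i : ℝ) * (C' * A * (k ^ n * (n ! : ℝ) ^ s)) := by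
        rw [Finset.mul_sum]
        refine Finset.sum_le_sum fun i hi => ?_
        have hin : i ≤ n := Nat.lt_succ_iff.mp (Finset.mem_range.mp hi)
        have e1 := (norm_iteratedFDeriv_character ξ i x).trans (hC i)
        have e2 := h (n - i)
        have e3 : (i ! : ℝ) ^ s * ((n - i)! : ℝ) ^ s ≤ (n ! : ℝ) ^ s := by
          rw [← Real.mul_rpow (by positivity) (by positivity)]
          refine Real.rpow_le_rpow (by positivity) ?_ hs.le
          exact_mod_cast Nat.le_of_dvd (Nat.factorial_pos _)
            (Nat.factorial_mul_factorial_dvd_factorial hin)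
        set a := ‖iteratedFDeriv ℝ i
          (fun y : E d => Complex.exp (Complex.I * ((inner ℝ y ξ : ℝ) : ℂ))) x‖
        set b := ‖iteratedFDeriv ℝ (n - i) f x‖
        have hkn : k ^ i * k ^ (n - i) = k ^ n := by rw [← pow_add]; congr 1; omega
        calc W * ((n.choose i : ℝ) * a * b) = (n.choose i : ℝ) * (a * (W * b)) := by ring
          _ ≤ (n.choose i : ℝ) * ((C' * (k ^ i * (i ! : ℝ) ^ s)) *
              (A * (k ^ (n - i) * ((n - i)! : ℝ) ^ s))) := by
              gcongr
          _ = (n.choose i : ℝ) * (C' * A * ((k ^ i * k ^ (n - i)) *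
              ((i ! : ℝ) ^ s * ((n - i)! : ℝ) ^ s))) := by ring
          _ ≤ _ := by rw [hkn]; gcongr
    _ = C' * A * ((2 * k) ^ n * (n ! : ℝ) ^ s) := by
        rw [← Finset.sum_mul]
        have : ∑ i ∈ Finset.range (n + 1), (n.choose i : ℝ) = 2 ^ n := by
          exact_mod_cast Nat.sum_range_choose n
        rw [this, mul_pow]; ring

/-- The multi-index form of the estimate for modulations. -/
theorem mderiv_modFun_le {d : ℕ} {s : ℝ} (hs : 0 < s) (ξ : E d) {h : ℝ} (hh : 0 < h) :
    ∃ C' k : ℝ, 1 ≤ C' ∧ 0 < k ∧ k ≤ h ∧ ∀ f : E d → ℂ, ContDiff ℝ ∞ f → ∀ W A : ℝ,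
      0 ≤ W → 0 ≤ A → ∀ x : E d,
      (∀ β, W * ‖mderiv β f x‖ ≤ A * (k ^ mlen β * (mfact β : ℝ) ^ s)) →
      ∀ β, W * ‖mderiv β (modFun ξ f) x‖ ≤ C' * A * (h ^ mlen β * (mfact β : ℝ) ^ s) := by
  set D : ℝ := (d : ℝ) + 1
  have hD1 : 1 ≤ D := by simp [D]
  have hDs : 1 ≤ D ^ s := Real.one_le_rpow hD1 hs.le
  set k : ℝ := h / (D ^ s * (2 * D)) with hk_def
  have hk : 0 < k := by positivity
  obtain ⟨C', hC1, hC⟩ := norm_modFun_le hs ξ (k := D * k) (by positivity)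
  refine ⟨C', k, hC1, hk, div_le_self hh.le (by nlinarith), fun f hf W A hW hA x hb β => ?_⟩
  have h1 := hC f hf W A hW hA x (norm_le_of_multi hs.le hf hW hA hk hb)
  have h2 := multi_le_of_norm hs.le (contDiff_modFun ξ hf) hW (by positivity) (by positivity) h1 β
  have h3 : D ^ s * (2 * (D * k)) = h := by rw [hk_def]; field_simp
  rwa [h3] at h2

theorem pderiv_transFun {d : ℕ} (a : E d) (j : Fin d) (f : E d → ℂ) :
    pderiv j (transFun a f) = transFun a (pderiv j f) := by
  funext x
  change fderiv ℝ (fun y => f (y - a)) x _ = fderiv ℝ f (x - a) _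
  rw [fderiv_comp_sub]

theorem mderiv_transFun {d : ℕ} (a : E d) (β : Fin d → ℕ) (f : E d → ℂ) :
    mderiv β (transFun a f) = transFun a (mderiv β f) := by
  rw [mderiv_eq_foldr, mderiv_eq_foldr]
  induction dirs β with
  | nil => rfl
  | cons j l ih => rw [List.foldr_cons, ih, pderiv_transFun]; rfl

theorem pderiv_conjFun {d : ℕ} (j : Fin d) (f : E d → ℂ) :
    pderiv j (conjFun f) = conjFun (pderiv j f) := by
  funext x
  change fderiv ℝ (Complex.conjCLE ∘ f) x _ = _
  rw [ContinuousLinearEquiv.comp_fderiv]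
  rfl

theorem mderiv_conjFun {d : ℕ} (β : Fin d → ℕ) (f : E d → ℂ) :
    mderiv β (conjFun f) = conjFun (mderiv β f) := by
  rw [mderiv_eq_foldr, mderiv_eq_foldr]
  induction dirs β with
  | nil => rfl
  | cons j l ih => rw [List.foldr_cons, ih, pderiv_conjFun]; rfl

theorem mderiv_add {d : ℕ} (β : Fin d → ℕ) {f g : E d → ℂ} (hf : ContDiff ℝ ∞ f)
    (hg : ContDiff ℝ ∞ g) : mderiv β (f + g) = mderiv β f + mderiv β g := by
  simp only [mderiv_eq_foldr]
  induction dirs β with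
  | nil => rfl
  | cons j l ih =>
    rw [List.foldr_cons, ih]
    funext x
    change fderiv ℝ (l.foldr pderiv f + l.foldr pderiv g) x _ = _
    rw [fderiv_add ((contDiff_foldr l hf).differentiable (by simp) x)
      ((contDiff_foldr l hg).differentiable (by simp) x)]
    rfl

theorem mderiv_smul {d : ℕ} (β : Fin d → ℕ) (c : ℂ) {f : E d → ℂ} (hf : ContDiff ℝ ∞ f) :
    mderiv β (c • f) = c • mderiv β f := by
  simp only [mderiv_eq_foldr]
  induction dirs β with
  | nil => rfl
  | cons j l ih =>
    rw [List.foldr_cons, ih]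
    funext x
    change fderiv ℝ (c • l.foldr pderiv f) x _ = _
    rw [fderiv_const_smul ((contDiff_foldr l hf).differentiable (by simp) x)]
    rfl

theorem mderiv_zero {d : ℕ} (β : Fin d → ℕ) : mderiv β (0 : E d → ℂ) = 0 := by
  have := mderiv_smul β (0 : ℂ) (f := (0 : E d → ℂ)) contDiff_const
  simpa using this

theorem mderiv_eq_zero_of_notMem {d : ℕ} (β : Fin d → ℕ) {f : E d → ℂ} (hf : ContDiff ℝ ∞ f)
    {x : E d} (hx : x ∉ tsupport f) : mderiv β f x = 0 := by
  have h1 := norm_mderiv_le hf β x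
  have h2 : iteratedFDeriv ℝ (mlen β) f x = 0 := by
    by_contra h
    exact hx (support_iteratedFDeriv_subset (𝕜 := ℝ) (mlen β) h)
  rw [h2, norm_zero] at h1
  exact norm_le_zero_iff.mp h1

theorem abs_mpow_add_le {d : ℕ} (z a : E d) (α : Fin d → ℕ) :
    |mpow (z + a) α| ≤ ∑ S ∈ (Finset.univ : Finset (Fin d)).powerset, 2 ^ mlen α *
      (|mpow z (fun j => if j ∈ S then α j else 0)| *
        ∏ j ∈ Finset.univ \ S, ‖a‖ ^ α j) := by
  have h1 : |mpow (z + a) α| ≤ ∏ j, (2 ^ α j * (|z j| ^ α j + ‖a‖ ^ α j)) := by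
    unfold mpow
    rw [Finset.abs_prod]
    refine Finset.prod_le_prod (fun _ _ => abs_nonneg _) fun j _ => ?_
    rw [abs_pow]
    have h2 : |(z + a) j| ≤ |z j| + ‖a‖ :=
      (abs_add_le (z j) (a j)).trans (add_le_add le_rfl (PiLp.norm_apply_le a j))
    calc |(z + a) j| ^ α j ≤ (|z j| + ‖a‖) ^ α j := by gcongr
      _ ≤ 2 ^ (α j - 1) * (|z j| ^ α j + ‖a‖ ^ α j) :=
          add_pow_le (abs_nonneg _) (norm_nonneg _) _
      _ ≤ _ := by gcongr <;> norm_num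
  refine h1.trans (le_of_eq ?_)
  rw [Finset.prod_mul_distrib, Finset.prod_pow_eq_pow_sum, Finset.prod_add, Finset.mul_sum]
  refine Finset.sum_congr rfl fun S _ => ?_
  congr 2
  unfold mpow
  rw [Finset.abs_prod]
  rw [← Finset.prod_subset (Finset.subset_univ S)]
  · exact Finset.prod_congr rfl fun j hj => by simp [hj]
  · intro j _ hj; simp [hj]

/-! ### The Gelfand–Shilov space `Σ_t^s(ℝ^d)` of Beurling type and its dual -/

/-- The weight `h^{|α + β|} α!^t β!^s`. -/
noncomputable def gsWeight {d : ℕ} (t s h : ℝ) (α β : Fin d → ℕ) : ℝ :=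
  h ^ (mlen α + mlen β) * (mfact α : ℝ) ^ t * (mfact β : ℝ) ^ s

/-- Membership in `Σ_t^s(ℝ^d)`: `f` is smooth and, for every `h > 0`,
`sup_{α, β, x} |x^α D^β f(x)| / (h^{|α + β|} α!^t β!^s)` is finite. -/
def MemGS {d : ℕ} (t s : ℝ) (f : E d → ℂ) : Prop :=
  ContDiff ℝ ∞ f ∧ ∀ h : ℝ, 0 < h → ∃ C : ℝ, ∀ (α β : Fin d → ℕ) (x : E d),
    |mpow x α| * ‖mderiv β f x‖ ≤ C * gsWeight t s h α β

theorem gsWeight_pos {d : ℕ} (t s : ℝ) {h : ℝ} (hh : 0 < h) (α β : Fin d → ℕ) :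
    0 < gsWeight t s h α β := by
  have h1 := mfact_pos α
  have h2 := mfact_pos β
  unfold gsWeight
  positivity

theorem gsWeight_mono {d : ℕ} (t s : ℝ) {h k : ℝ} (hk : 0 < k) (hkh : k ≤ h) (α β : Fin d → ℕ) :
    gsWeight t s k α β ≤ gsWeight t s h α β := by
  have h1 := mfact_pos α
  have h2 := mfact_pos β
  unfold gsWeight
  gcongr

theorem gsWeight_split {d : ℕ} (t s h : ℝ) (α β : Fin d → ℕ) : gsWeight t s h α β =
    (h ^ mlen α * (mfact α : ℝ) ^ t) * (h ^ mlen β * (mfact β : ℝ) ^ s) := by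
  unfold gsWeight; rw [pow_add]; ring

theorem nonneg_of_bound {d : ℕ} {t s h C : ℝ} (hh : 0 < h) {f : E d → ℂ}
    (hC : ∀ (α β : Fin d → ℕ) (x : E d), |mpow x α| * ‖mderiv β f x‖ ≤ C * gsWeight t s h α β) :
    0 ≤ C := by
  have h1 := hC 0 0 0
  have h2 := gsWeight_pos t s hh (0 : Fin d → ℕ) 0
  have h3 : 0 ≤ C * gsWeight t s h (0 : Fin d → ℕ) 0 := le_trans (by positivity) h1
  exact nonneg_of_mul_nonneg_left h3 h2

/-- `Σ_t^s(ℝ^d)` as a space of functions. -/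
noncomputable def gsSubmodule (d : ℕ) (t s : ℝ) : Submodule ℂ (E d → ℂ) where
  carrier := {f | MemGS t s f}
  zero_mem' := ⟨contDiff_const, fun h _ => ⟨0, fun α β x => by simp [mderiv_zero]⟩⟩
  add_mem' := by
    rintro f g ⟨hf, hfb⟩ ⟨hg, hgb⟩
    refine ⟨hf.add hg, fun h hh => ?_⟩
    obtain ⟨C1, h1⟩ := hfb h hh
    obtain ⟨C2, h2⟩ := hgb h hh
    refine ⟨C1 + C2, fun α β x => ?_⟩
    rw [mderiv_add β hf hg]
    calc |mpow x α| * ‖mderiv β f x + mderiv β g x‖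
        ≤ |mpow x α| * (‖mderiv β f x‖ + ‖mderiv β g x‖) := by gcongr; exact norm_add_le _ _
      _ ≤ _ := by linarith [h1 α β x, h2 α β x]
  smul_mem' := by
    rintro c f ⟨hf, hfb⟩
    refine ⟨contDiff_const.smul hf, fun h hh => ?_⟩
    obtain ⟨C1, h1⟩ := hfb h hh
    refine ⟨‖c‖ * C1, fun α β x => ?_⟩
    rw [mderiv_smul β c hf, Pi.smul_apply, norm_smul]
    calc |mpow x α| * (‖c‖ * ‖mderiv β f x‖) = ‖c‖ * (|mpow x α| * ‖mderiv β f x‖) := by ring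
      _ ≤ ‖c‖ * (C1 * gsWeight t s h α β) :=
          mul_le_mul_of_nonneg_left (h1 α β x) (norm_nonneg c)
      _ = _ := by ring

/-- The Gelfand–Shilov space `Σ_t^s(ℝ^d)` of Beurling type; it is given its Fréchet space topology
below. -/
def GelfandShilov (d : ℕ) (t s : ℝ) : Type := ↥(gsSubmodule d t s)

noncomputable instance (d : ℕ) (t s : ℝ) : AddCommGroup (GelfandShilov d t s) :=
  inferInstanceAs (AddCommGroup ↥(gsSubmodule d t s))

noncomputable instance (d : ℕ) (t s : ℝ) : Module ℂ (GelfandShilov d t s) :=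
  inferInstanceAs (Module ℂ ↥(gsSubmodule d t s))

namespace GelfandShilov

variable {d : ℕ} {t s : ℝ}

/-- The underlying function of an element of `Σ_t^s(ℝ^d)`. -/
def toFun (f : GelfandShilov d t s) : E d → ℂ := f.1

/-- A function satisfying the defining estimates, as an element of `Σ_t^s(ℝ^d)`. -/
def mk (f : E d → ℂ) (hf : MemGS t s f) : GelfandShilov d t s := ⟨f, hf⟩

theorem mem (f : GelfandShilov d t s) : MemGS t s f.toFun := f.2

theorem toFun_mk (f : E d → ℂ) (hf : MemGS t s f) : (mk f hf).toFun = f := rfl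

theorem ext {f g : GelfandShilov d t s} (h : f.toFun = g.toFun) : f = g := Subtype.ext h

theorem toFun_add (f g : GelfandShilov d t s) : (f + g).toFun = f.toFun + g.toFun := rfl

theorem toFun_smul (c : ℂ) (f : GelfandShilov d t s) : (c • f).toFun = c • f.toFun := rfl

theorem toFun_zero : (0 : GelfandShilov d t s).toFun = 0 := rfl

/-- The quotient whose supremum over `α`, `β`, `x` is the norm of `f` in `S_{t,h}^s`. -/
noncomputable def ratio (h : ℝ) (f : GelfandShilov d t s)
    (p : (Fin d → ℕ) × (Fin d → ℕ) × E d) : ℝ :=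
  |mpow p.2.2 p.1| * ‖mderiv p.2.1 f.toFun p.2.2‖ / gsWeight t s h p.1 p.2.1

theorem ratio_nonneg {h : ℝ} (hh : 0 < h) (f : GelfandShilov d t s)
    (p : (Fin d → ℕ) × (Fin d → ℕ) × E d) : 0 ≤ ratio h f p :=
  div_nonneg (by positivity) (gsWeight_pos t s hh _ _).le

theorem bddAbove_ratio {h : ℝ} (hh : 0 < h) (f : GelfandShilov d t s) :
    BddAbove (Set.range (ratio h f)) := by
  obtain ⟨C, hC⟩ := f.mem.2 h hh
  refine ⟨C, ?_⟩
  rintro _ ⟨p, rfl⟩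
  exact (div_le_iff₀ (gsWeight_pos t s hh _ _)).mpr (hC _ _ _)

/-- The norm `‖f‖ = sup_{α, β, x} |x^α D^β f(x)| / (h^{|α + β|} α!^t β!^s)` of `S_{t,h}^s(ℝ^d)`,
as a seminorm on `Σ_t^s(ℝ^d)`, for `h > 0`. -/
noncomputable def seminorm (d : ℕ) (t s : ℝ) (h : {h : ℝ // 0 < h}) :
    Seminorm ℂ (GelfandShilov d t s) :=
  Seminorm.ofSMulLE (fun f => ⨆ p, ratio h.1 f p)
    (by
      have : ∀ p, ratio h.1 (0 : GelfandShilov d t s) p = 0 := by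
        intro p
        simp [ratio, toFun_zero, mderiv_zero]
      simp [this])
    (by
      intro f g
      refine ciSup_le fun p => ?_
      have h1 := le_ciSup (bddAbove_ratio h.2 f) p
      have h2 := le_ciSup (bddAbove_ratio h.2 g) p
      refine le_trans ?_ (add_le_add h1 h2)
      unfold ratio
      rw [← add_div, toFun_add, mderiv_add _ f.mem.1 g.mem.1, ← mul_add]
      refine div_le_div_of_nonneg_right ?_ (gsWeight_pos t s h.2 _ _).le
      exact mul_le_mul_of_nonneg_left (norm_add_le _ _) (abs_nonneg _))
    (by
      intro c f
      refine ciSup_le fun p => ?_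
      have h1 := le_ciSup (bddAbove_ratio h.2 f) p
      refine le_trans (le_of_eq ?_) (mul_le_mul_of_nonneg_left h1 (norm_nonneg c))
      unfold ratio
      rw [toFun_smul, mderiv_smul _ _ f.mem.1, Pi.smul_apply, norm_smul]
      ring)

theorem seminorm_apply (h : {h : ℝ // 0 < h}) (f : GelfandShilov d t s) :
    seminorm d t s h f = ⨆ p, ratio h.1 f p := rfl

theorem le_seminorm (h : {h : ℝ // 0 < h}) (f : GelfandShilov d t s) (α β : Fin d → ℕ) (x : E d) :
    |mpow x α| * ‖mderiv β f.toFun x‖ ≤ seminorm d t s h f * gsWeight t s h.1 α β := by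
  rw [← div_le_iff₀ (gsWeight_pos t s h.2 _ _)]
  exact le_ciSup (bddAbove_ratio h.2 f) (α, β, x)

theorem seminorm_le (h : {h : ℝ // 0 < h}) (f : GelfandShilov d t s) {C : ℝ}
    (hC : ∀ (α β : Fin d → ℕ) (x : E d),
      |mpow x α| * ‖mderiv β f.toFun x‖ ≤ C * gsWeight t s h.1 α β) :
    seminorm d t s h f ≤ C :=
  ciSup_le fun _ => (div_le_iff₀ (gsWeight_pos t s h.2 _ _)).mpr (hC _ _ _)

theorem seminorm_anti {h k : {h : ℝ // 0 < h}} (hkh : k.1 ≤ h.1) :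
    seminorm d t s h ≤ seminorm d t s k := by
  intro f
  refine seminorm_le h f fun α β x => (le_seminorm k f α β x).trans ?_
  exact mul_le_mul_of_nonneg_left (gsWeight_mono t s k.2 hkh α β) (apply_nonneg _ _)

instance : Nonempty {h : ℝ // 0 < h} := ⟨⟨1, one_pos⟩⟩

/-- The Fréchet space topology of `Σ_t^s(ℝ^d)`, defined by the norms of `S_{t,h}^s(ℝ^d)`,
`h > 0`. -/
noncomputable instance : TopologicalSpace (GelfandShilov d t s) :=
  (SeminormFamily.moduleFilterBasis (seminorm d t s)).topology

theorem withSeminorms (d : ℕ) (t s : ℝ) : WithSeminorms (seminorm d t s) := ⟨rfl⟩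

end GelfandShilov

/-- The space `(Σ_t^s)'(ℝ^d)` of Gelfand–Shilov ultradistributions: the topological dual. The value
`u f` is the bilinear pairing; the pairing which is conjugate linear in the test function is
`(u, f) = u (conj f)`. -/
abbrev GelfandShilovDual (d : ℕ) (t s : ℝ) : Type := GelfandShilov d t s →L[ℂ] ℂ

theorem memGS_modFun {d : ℕ} {t s : ℝ} (hs : 0 < s) (ξ : E d) {f : E d → ℂ}
    (hf : MemGS t s f) : MemGS t s (modFun ξ f) := by
  refine ⟨contDiff_modFun ξ hf.1, fun h hh => ?_⟩
  obtain ⟨C', k, hC1, hk, hkh, hC⟩ := mderiv_modFun_le hs ξ hh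
  obtain ⟨C, hCf⟩ := hf.2 k hk
  have hC0 := nonneg_of_bound hk hCf
  refine ⟨C' * C, fun α β x => ?_⟩
  have hα := mfact_pos α
  have h1 := hC f hf.1 |mpow x α| (C * (k ^ mlen α * (mfact α : ℝ) ^ t)) (abs_nonneg _)
    (by positivity) x (fun β => by
      have := hCf α β x
      rw [gsWeight_split] at this
      linarith) β
  refine h1.trans ?_
  rw [gsWeight_split]
  have hβ := mfact_pos β
  have h2 : k ^ mlen α ≤ h ^ mlen α := by gcongr
  calc C' * (C * (k ^ mlen α * (mfact α : ℝ) ^ t)) * (h ^ mlen β * (mfact β : ℝ) ^ s)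
      ≤ C' * (C * (h ^ mlen α * (mfact α : ℝ) ^ t)) * (h ^ mlen β * (mfact β : ℝ) ^ s) := by
        gcongr
    _ = _ := by ring

theorem memGS_conjFun {d : ℕ} {t s : ℝ} {f : E d → ℂ} (hf : MemGS t s f) :
    MemGS t s (conjFun f) := by
  refine ⟨Complex.conjCLE.contDiff.comp hf.1, fun h hh => ?_⟩
  obtain ⟨C, hC⟩ := hf.2 h hh
  refine ⟨C, fun α β x => ?_⟩
  rw [mderiv_conjFun]
  change _ * ‖starRingEnd ℂ (mderiv β f x)‖ ≤ _
  rw [RCLike.norm_conj]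
  exact hC α β x

theorem memGS_transFun {d : ℕ} {t s : ℝ} (ht : 0 < t) (a : E d) {f : E d → ℂ}
    (hf : MemGS t s f) : MemGS t s (transFun a f) := by
  refine ⟨hf.1.comp (contDiff_id.sub contDiff_const), fun h hh => ?_⟩
  obtain ⟨C, hC⟩ := hf.2 (h / 2) (by positivity)
  have hC0 := nonneg_of_bound (by positivity) hC
  obtain ⟨C', hC1, hC'⟩ := exists_pow_le ht ‖a‖ (norm_nonneg _) (k := h / 2) (by positivity)
  have hC'0 : 0 ≤ C' := by linarith
  refine ⟨2 ^ d * (C * C' ^ d), fun α β x => ?_⟩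
  rw [mderiv_transFun]
  set z := x - a with hz
  have hx : x = z + a := by simp [hz]
  change |mpow x α| * ‖mderiv β f z‖ ≤ _
  have hβ := mfact_pos β
  have key : ∀ S : Finset (Fin d), 2 ^ mlen α *
      (|mpow z (fun j => if j ∈ S then α j else 0)| * ∏ j ∈ Finset.univ \ S, ‖a‖ ^ α j) *
        ‖mderiv β f z‖ ≤ C * C' ^ d * gsWeight t s h α β := by
    intro S
    set γ : Fin d → ℕ := fun j => if j ∈ S then α j else 0 with hγ
    have e1 := hC γ β z
    have e2 : ∏ j ∈ Finset.univ \ S, ‖a‖ ^ α j ≤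
        C' ^ d * ∏ j ∈ Finset.univ \ S, ((h / 2) ^ α j * ((α j)! : ℝ) ^ t) := by
      calc ∏ j ∈ Finset.univ \ S, ‖a‖ ^ α j
          ≤ ∏ j ∈ Finset.univ \ S, C' * ((h / 2) ^ α j * ((α j)! : ℝ) ^ t) :=
            Finset.prod_le_prod (fun _ _ => by positivity) fun j _ => hC' _
        _ = C' ^ (Finset.univ \ S).card *
            ∏ j ∈ Finset.univ \ S, ((h / 2) ^ α j * ((α j)! : ℝ) ^ t) := by
            rw [Finset.prod_mul_distrib, Finset.prod_const]
        _ ≤ _ := by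
            refine mul_le_mul_of_nonneg_right (pow_le_pow_right₀ hC1 ?_)
              (Finset.prod_nonneg fun _ _ => by positivity)
            exact (Finset.card_le_univ _).trans (by simp)
    have e3 : ((h / 2) ^ mlen γ * (mfact γ : ℝ) ^ t) *
        ∏ j ∈ Finset.univ \ S, ((h / 2) ^ α j * ((α j)! : ℝ) ^ t) =
        (h / 2) ^ mlen α * (mfact α : ℝ) ^ t := by
      have g : ∀ δ : Fin d → ℕ, (h / 2) ^ mlen δ * (mfact δ : ℝ) ^ t =
          ∏ j, ((h / 2) ^ δ j * ((δ j)! : ℝ) ^ t) := by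
        intro δ
        unfold mlen mfact
        push_cast
        rw [Finset.prod_mul_distrib, Finset.prod_pow_eq_pow_sum,
          Real.finsetProd_rpow _ _ (fun _ _ => by positivity)]
      rw [g, g]
      have g2 : ∏ j, ((h / 2) ^ γ j * ((γ j)! : ℝ) ^ t) =
          ∏ j ∈ S, ((h / 2) ^ α j * ((α j)! : ℝ) ^ t) := by
        rw [← Finset.prod_subset (Finset.subset_univ S)]
        · exact Finset.prod_congr rfl fun j hj => by simp [hγ, hj]
        · intro j _ hj; simp [hγ, hj]
      rw [g2, mul_comm, Finset.prod_sdiff (Finset.subset_univ S)]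
    rw [gsWeight_split] at e1
    set P := ∏ j ∈ Finset.univ \ S, ‖a‖ ^ α j
    set Q := ∏ j ∈ Finset.univ \ S, ((h / 2) ^ α j * ((α j)! : ℝ) ^ t)
    have hP : 0 ≤ P := Finset.prod_nonneg fun _ _ => by positivity
    have hγ0 := mfact_pos γ
    have hα0 := mfact_pos α
    have hh2 : (h / 2) ^ mlen β ≤ h ^ mlen β := by gcongr; linarith
    calc 2 ^ mlen α * (|mpow z γ| * P) * ‖mderiv β f z‖
        = 2 ^ mlen α * ((|mpow z γ| * ‖mderiv β f z‖) * P) := by ring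
      _ ≤ 2 ^ mlen α * ((C * (((h / 2) ^ mlen γ * (mfact γ : ℝ) ^ t) *
          ((h / 2) ^ mlen β * (mfact β : ℝ) ^ s))) * (C' ^ d * Q)) := by gcongr
      _ = C * C' ^ d * (2 ^ mlen α * (((h / 2) ^ mlen γ * (mfact γ : ℝ) ^ t) * Q) *
          ((h / 2) ^ mlen β * (mfact β : ℝ) ^ s)) := by ring
      _ = C * C' ^ d * ((h ^ mlen α * (mfact α : ℝ) ^ t) *
          ((h / 2) ^ mlen β * (mfact β : ℝ) ^ s)) := by
          rw [e3]; congr 2; rw [← mul_assoc, ← mul_pow]; congr 2; ring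
      _ ≤ C * C' ^ d * ((h ^ mlen α * (mfact α : ℝ) ^ t) *
          (h ^ mlen β * (mfact β : ℝ) ^ s)) := by gcongr
      _ = _ := by rw [gsWeight_split]
  calc |mpow x α| * ‖mderiv β f z‖
      ≤ (∑ S ∈ (Finset.univ : Finset (Fin d)).powerset, 2 ^ mlen α *
      (|mpow z (fun j => if j ∈ S then α j else 0)| *
        ∏ j ∈ Finset.univ \ S, ‖a‖ ^ α j)) * ‖mderiv β f z‖ := by
        rw [hx]; gcongr; exact abs_mpow_add_le z a α
    _ ≤ ∑ S ∈ (Finset.univ : Finset (Fin d)).powerset, C * C' ^ d * gsWeight t s h α β := by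
        rw [Finset.sum_mul]
        exact Finset.sum_le_sum fun S _ => key S
    _ = _ := by
        rw [Finset.sum_const, Finset.card_powerset]
        simp; ring

namespace GelfandShilov

variable {d : ℕ} {t s : ℝ}

/-- Modulation `M_ξ f(y) = e^{i⟨y, ξ⟩} f(y)` on `Σ_t^s(ℝ^d)`. -/
noncomputable def modulate (hs : 0 < s) (ξ : E d) (f : GelfandShilov d t s) :
    GelfandShilov d t s := mk (modFun ξ f.toFun) (memGS_modFun hs ξ f.mem)

/-- Translation `T_x f(y) = f(y - x)` on `Σ_t^s(ℝ^d)`. -/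
noncomputable def translate (ht : 0 < t) (x : E d) (f : GelfandShilov d t s) :
    GelfandShilov d t s := mk (transFun x f.toFun) (memGS_transFun ht x f.mem)

/-- Complex conjugation on `Σ_t^s(ℝ^d)`. -/
noncomputable def conj (f : GelfandShilov d t s) : GelfandShilov d t s :=
  mk (conjFun f.toFun) (memGS_conjFun f.mem)

end GelfandShilov

/-- The short-time Fourier transform
`V_ψ u(x, ξ) = (2π)^{-d/2} (u, M_ξ T_x ψ)` of `u ∈ (Σ_t^s)'(ℝ^d)` with window `ψ ∈ Σ_t^s(ℝ^d)`,
where the pairing is conjugate linear in the test function. -/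
noncomputable def stft {d : ℕ} {t s : ℝ} (ht : 0 < t) (hs : 0 < s) (ψ : GelfandShilov d t s)
    (u : GelfandShilovDual d t s) (x ξ : E d) : ℂ :=
  (((2 * Real.pi) ^ (-(d : ℝ) / 2) : ℝ) : ℂ) * u ((ψ.translate ht x).modulate hs ξ).conj

/-- The `t,s`-Gelfand–Shilov wave front set `WF^{t,s}(u) ⊆ T^*ℝ^d ∖ 0`, computed with the window
`ψ`: a point `(x₀, ξ₀) ≠ 0` lies outside it iff it has an open neighbourhood `U ⊆ T^*ℝ^d ∖ 0` with
`sup_{λ > 0, (x, ξ) ∈ U} e^{rλ} |V_ψ u(λ^t x, λ^s ξ)| < ∞` for all `r > 0`. -/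
def gsWaveFrontSet {d : ℕ} {t s : ℝ} (ht : 0 < t) (hs : 0 < s) (ψ : GelfandShilov d t s)
    (u : GelfandShilovDual d t s) : Set (E d × E d) :=
  {z₀ | z₀ ≠ 0 ∧ ¬ ∃ U : Set (E d × E d), IsOpen U ∧ (0 : E d × E d) ∉ U ∧ z₀ ∈ U ∧
    ∀ r : ℝ, 0 < r → ∃ C : ℝ, ∀ l : ℝ, 0 < l → ∀ z ∈ U,
      Real.exp (r * l) * ‖stft ht hs ψ u (l ^ t • z.1) (l ^ s • z.2)‖ ≤ C}

/-! ### Gevrey functions, Gevrey ultradistributions and the Gevrey wave front set -/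

/-- Membership in `G^s(ℝ^d)` (Beurling type): `f` is smooth and for each compact `K` and each
`h > 0` there is `C` with `|∂^α f(x)| ≤ C h^{|α|} α!^s` for `x ∈ K` and all `α`. -/
def IsGevrey {d : ℕ} (s : ℝ) (f : E d → ℂ) : Prop :=
  ContDiff ℝ ∞ f ∧ ∀ K : Set (E d), IsCompact K → ∀ h : ℝ, 0 < h → ∃ C : ℝ, ∀ x ∈ K,
    ∀ α : Fin d → ℕ, ‖mderiv α f x‖ ≤ C * (h ^ mlen α * (mfact α : ℝ) ^ s)

theorem isGevrey_modFun {d : ℕ} {s : ℝ} (hs : 0 < s) (ξ : E d) {f : E d → ℂ}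
    (hf : IsGevrey s f) : IsGevrey s (modFun ξ f) := by
  refine ⟨contDiff_modFun ξ hf.1, fun K hK h hh => ?_⟩
  obtain ⟨C', k, hC1, hk, hkh, hC⟩ := mderiv_modFun_le hs ξ hh
  obtain ⟨C, hCf⟩ := hf.2 K hK k hk
  refine ⟨C' * C, fun x hx α => ?_⟩
  have hC0 : 0 ≤ C := by
    have h1 := (norm_nonneg _).trans (hCf x hx 0)
    have h2 := mfact_pos (0 : Fin d → ℕ)
    exact nonneg_of_mul_nonneg_left h1 (by positivity)
  have := hC f hf.1 1 C zero_le_one hC0 x (fun β => by rw [one_mul]; exact hCf x hx β) α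
  rwa [one_mul] at this

/-- The space `G_c^s(ℝ^d)` of compactly supported Gevrey functions of order `s`. -/
noncomputable def gevreyC (d : ℕ) (s : ℝ) : Submodule ℂ (E d → ℂ) where
  carrier := {f | IsGevrey s f ∧ HasCompactSupport f}
  zero_mem' := ⟨⟨contDiff_const, fun K _ h _ => ⟨0, fun x _ α => by simp [mderiv_zero]⟩⟩,
    HasCompactSupport.zero⟩
  add_mem' := by
    rintro f g ⟨⟨hf, hfb⟩, hfc⟩ ⟨⟨hg, hgb⟩, hgc⟩
    refine ⟨⟨hf.add hg, fun K hK h hh => ?_⟩, hfc.add hgc⟩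
    obtain ⟨C1, h1⟩ := hfb K hK h hh
    obtain ⟨C2, h2⟩ := hgb K hK h hh
    refine ⟨C1 + C2, fun x hx α => ?_⟩
    rw [mderiv_add α hf hg, add_mul]
    exact (norm_add_le _ _).trans (add_le_add (h1 x hx α) (h2 x hx α))
  smul_mem' := by
    rintro c f ⟨⟨hf, hfb⟩, hfc⟩
    refine ⟨⟨contDiff_const.smul hf, fun K hK h hh => ?_⟩, hfc.smul_left (f := fun _ => c)⟩
    obtain ⟨C1, h1⟩ := hfb K hK h hh
    refine ⟨‖c‖ * C1, fun x hx α => ?_⟩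
    rw [mderiv_smul α c hf, Pi.smul_apply, norm_smul, mul_assoc]
    exact mul_le_mul_of_nonneg_left (h1 x hx α) (norm_nonneg c)

/-- Modulation `M_ξ f(y) = e^{i⟨y, ξ⟩} f(y)` on `G_c^s(ℝ^d)`. -/
noncomputable def gevreyModulate {d : ℕ} {s : ℝ} (hs : 0 < s) (ξ : E d) (f : gevreyC d s) :
    gevreyC d s :=
  ⟨modFun ξ f.1, isGevrey_modFun hs ξ f.2.1, f.2.2.mul_left⟩

/-- The space `𝒟_s'(ℝ^d)` of Gevrey ultradistributions (Beurling type): the linear functionals on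
`G_c^s(ℝ^d)` whose restriction to the Fréchet space of functions of `G_c^s(ℝ^d)` supported in `K`,
normed by `sup_{α, x} |∂^α f(x)| / (h^{|α|} α!^s)` for `h > 0`, is continuous for each
compact `K`. -/
structure GevreyUltradistribution (d : ℕ) (s : ℝ) where
  /-- The functional; its value at `f` is the bilinear pairing. -/
  toLinearMap : gevreyC d s →ₗ[ℂ] ℂ
  continuous' : ∀ K : Set (E d), IsCompact K → ∃ h : ℝ, 0 < h ∧ ∃ C : ℝ, ∀ f : gevreyC d s,
    tsupport f.1 ⊆ K → ∀ B : ℝ,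
      (∀ (α : Fin d → ℕ) (x : E d), ‖mderiv α f.1 x‖ ≤ B * (h ^ mlen α * (mfact α : ℝ) ^ s)) →
      ‖toLinearMap f‖ ≤ C * B

/-- The Fourier transform `ξ ↦ (2π)^{-d/2} ⟨v χ, e^{-i⟨·, ξ⟩}⟩ = (2π)^{-d/2} ⟨v, χ e^{-i⟨·, ξ⟩}⟩` of
the compactly supported ultradistribution `v χ`, where `v ∈ 𝒟_s'(ℝ^d)` and `χ ∈ G_c^s(ℝ^d)`. -/
noncomputable def localFourier {d : ℕ} {s : ℝ} (hs : 0 < s) (v : GevreyUltradistribution d s)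
    (χ : gevreyC d s) (ξ : E d) : ℂ :=
  (((2 * Real.pi) ^ (-(d : ℝ) / 2) : ℝ) : ℂ) * v.toLinearMap (gevreyModulate hs (-ξ) χ)

/-- The Gevrey wave front set `WF_s(v) ⊆ ℝ^d × (ℝ^d ∖ 0)` of `v ∈ 𝒟_s'(ℝ^d)`: a point `(x₀, ξ₀)`
with `ξ₀ ≠ 0` lies outside it iff there are `χ ∈ G_c^s(ℝ^d)` with `χ(x₀) = 1` and an open conic set
`Γ ⊆ ℝ^d ∖ 0` containing `ξ₀` such that `sup_{ξ ∈ Γ} e^{r |ξ|^{1/s}} |(v χ)^(ξ)| < ∞` for all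
`r > 0`. -/
def gevreyWaveFrontSet {d : ℕ} {s : ℝ} (hs : 0 < s) (v : GevreyUltradistribution d s) :
    Set (E d × E d) :=
  {z₀ | z₀.2 ≠ 0 ∧ ¬ ∃ χ : gevreyC d s, χ.1 z₀.1 = 1 ∧ ∃ Γ : Set (E d), IsOpen Γ ∧
    (∀ l : ℝ, 0 < l → ∀ ξ ∈ Γ, l • ξ ∈ Γ) ∧ (0 : E d) ∉ Γ ∧ z₀.2 ∈ Γ ∧
    ∀ r : ℝ, 0 < r → ∃ C : ℝ, ∀ ξ ∈ Γ,
      Real.exp (r * ‖ξ‖ ^ (1 / s)) * ‖localFourier hs v χ ξ‖ ≤ C}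

/-! ### The inclusions `G_c^s ⊆ Σ_t^s` and `(Σ_t^s)' ⊆ 𝒟_s'` -/

theorem exists_mpow_le {d : ℕ} {t : ℝ} (ht : 0 < t) {K : Set (E d)} (hK : IsCompact K) {h : ℝ}
    (hh : 0 < h) : ∃ M : ℝ, 0 < M ∧ ∀ x ∈ K, ∀ α : Fin d → ℕ,
      |mpow x α| ≤ M * (h ^ mlen α * (mfact α : ℝ) ^ t) := by
  obtain ⟨R, hR⟩ := hK.isBounded.exists_norm_le
  obtain ⟨C, hC1, hC⟩ := exists_pow_le ht (max R 0) (le_max_right _ _) hh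
  refine ⟨C ^ d, by positivity, fun x hx α => ?_⟩
  have hw : h ^ mlen α * (mfact α : ℝ) ^ t = ∏ j, (h ^ α j * ((α j)! : ℝ) ^ t) := by
    unfold mlen mfact
    push_cast
    rw [Finset.prod_mul_distrib, Finset.prod_pow_eq_pow_sum,
      Real.finsetProd_rpow _ _ (fun _ _ => by positivity)]
  calc |mpow x α| = ∏ j, |x j| ^ α j := by unfold mpow; rw [Finset.abs_prod]; simp
    _ ≤ ∏ j, C * (h ^ α j * ((α j)! : ℝ) ^ t) := by
        refine Finset.prod_le_prod (fun _ _ => by positivity) fun j _ => ?_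
        refine le_trans ?_ (hC (α j))
        have h1 : |x j| ≤ max R 0 :=
          ((PiLp.norm_apply_le x j).trans (hR x hx)).trans (le_max_left _ _)
        gcongr
    _ = _ := by rw [Finset.prod_mul_distrib, hw]; simp

theorem mul_mderiv_le {d : ℕ} {t s h M B : ℝ} {K : Set (E d)} (hh : 0 < h) (hM : 0 < M)
    (hMK : ∀ x ∈ K, ∀ α : Fin d → ℕ, |mpow x α| ≤ M * (h ^ mlen α * (mfact α : ℝ) ^ t))
    {f : E d → ℂ} (hf : ContDiff ℝ ∞ f) (hfK : tsupport f ⊆ K) (hB : 0 ≤ B)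
    (hfB : ∀ x ∈ K, ∀ α : Fin d → ℕ, ‖mderiv α f x‖ ≤ B * (h ^ mlen α * (mfact α : ℝ) ^ s))
    (α β : Fin d → ℕ) (x : E d) :
    |mpow x α| * ‖mderiv β f x‖ ≤ M * B * gsWeight t s h α β := by
  by_cases hx : x ∈ tsupport f
  · have h1 := hMK x (hfK hx) α
    have h2 := hfB x (hfK hx) β
    have hα := mfact_pos α
    calc |mpow x α| * ‖mderiv β f x‖
        ≤ (M * (h ^ mlen α * (mfact α : ℝ) ^ t)) * (B * (h ^ mlen β * (mfact β : ℝ) ^ s)) := by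
          gcongr
      _ = _ := by rw [gsWeight_split]; ring
  · rw [mderiv_eq_zero_of_notMem β hf hx, norm_zero, mul_zero]
    have := gsWeight_pos t s hh α β
    positivity

theorem memGS_of_gevreyC {d : ℕ} {t s : ℝ} (ht : 0 < t) {f : E d → ℂ} (hf : f ∈ gevreyC d s) :
    MemGS t s f := by
  obtain ⟨⟨hf, hfb⟩, hfc⟩ := hf
  refine ⟨hf, fun h hh => ?_⟩
  have hK : IsCompact (tsupport f) := hfc
  obtain ⟨C, hC⟩ := hfb _ hK h hh
  obtain ⟨M, hM, hMK⟩ := exists_mpow_le ht hK hh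
  refine ⟨M * max C 0, fun α β x => mul_mderiv_le hh hM hMK hf subset_rfl (le_max_right _ _) ?_ α β x⟩
  intro x hx α
  refine (hC x hx α).trans ?_
  have hα := mfact_pos α
  gcongr
  exact le_max_left _ _

/-- The inclusion `G_c^s(ℝ^d) ⊆ Σ_t^s(ℝ^d)`. -/
noncomputable def gevreyInclusion (d : ℕ) {t : ℝ} (s : ℝ) (ht : 0 < t) :
    gevreyC d s →ₗ[ℂ] GelfandShilov d t s where
  toFun f := GelfandShilov.mk f.1 (memGS_of_gevreyC ht f.2)
  map_add' _ _ := rfl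
  map_smul' _ _ := rfl

/-- The inclusion `(Σ_t^s)'(ℝ^d) ⊆ 𝒟_s'(ℝ^d)`: restriction of `u` to `G_c^s(ℝ^d)`. -/
noncomputable def GelfandShilovDual.toGevrey {d : ℕ} {t s : ℝ} (ht : 0 < t)
    (u : GelfandShilovDual d t s) : GevreyUltradistribution d s where
  toLinearMap := u.toLinearMap ∘ₗ gevreyInclusion d s ht
  continuous' := by
    intro K hK
    obtain ⟨S, C, -, hC⟩ := Seminorm.bound_of_continuous (GelfandShilov.withSeminorms d t s)
      ((normSeminorm ℂ ℂ).comp u.toLinearMap) (continuous_norm.comp u.continuous)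
    obtain ⟨k, hk⟩ : ∃ k : {h : ℝ // 0 < h}, S.sup (GelfandShilov.seminorm d t s) ≤
        GelfandShilov.seminorm d t s k := by
      clear hC
      induction S using Finset.induction with
      | empty => exact ⟨⟨1, one_pos⟩, by simp⟩
      | insert h S _ ih =>
        obtain ⟨k, hk⟩ := ih
        refine ⟨⟨min h.1 k.1, lt_min h.2 k.2⟩, ?_⟩
        rw [Finset.sup_insert]
        exact sup_le (GelfandShilov.seminorm_anti (min_le_left _ _))
          (hk.trans (GelfandShilov.seminorm_anti (min_le_right _ _)))
    obtain ⟨M, hM, hMK⟩ := exists_mpow_le ht hK k.2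
    refine ⟨k.1, k.2, C * M, fun f hf B hB => ?_⟩
    have hB0 : 0 ≤ B := by
      have h1 := (norm_nonneg _).trans (hB 0 0)
      have h2 := mfact_pos (0 : Fin d → ℕ)
      have h3 := k.2
      exact nonneg_of_mul_nonneg_left h1 (by positivity)
    have h1 : ‖u (gevreyInclusion d s ht f)‖ ≤
        (C • S.sup (GelfandShilov.seminorm d t s)) (gevreyInclusion d s ht f) := hC _
    have h2 : GelfandShilov.seminorm d t s k (gevreyInclusion d s ht f) ≤ M * B :=
      GelfandShilov.seminorm_le k _
        (mul_mderiv_le k.2 hM hMK f.2.1.1 hf hB0 fun x _ α => hB α x)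
    calc ‖u (gevreyInclusion d s ht f)‖
        ≤ C * S.sup (GelfandShilov.seminorm d t s) (gevreyInclusion d s ht f) := h1
      _ ≤ C * (M * B) := by
          gcongr
          exact (hk _).trans h2
      _ = _ := by ring

end GelfandShilovWF

/-! Fix `x₀` and let `(0, ξ₀) ∉ WF^{t,s}(u)`. A translate `ψ(· - x)` of the window does not vanish
at `x₀`, and multiplying its conjugate by a suitable Gevrey cutoff `g` gives `χ ∈ G_c^s` with
`χ(x₀) = 1`. By Fourier inversion for `g`, the Fourier transform of `u χ` is a convolution of `ĝ`
with `ξ ↦ V_ψ u(x, ξ)`. Here `ĝ` decays like `e^{-r|ξ|^{1/s}}` for every `r`, and `V_ψ u(x, ·)`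
grows at most like `e^{r|ξ|^{1/s}}` for some `r`. Moreover `V_ψ u(x, ·)` decays like
`e^{-r|ξ|^{1/s}}` for every `r` in a cone about `ξ₀`: as `x` is fixed, `(λ^{-t} x, λ^{-s} ξ)` is
close to `(0, ξ₀)` for a suitable `λ` comparable to `|ξ|^{1/s}`, when `ξ` is large. The convolution
inherits this decay in every smaller cone, so `(x₀, ξ₀) ∉ WF_s(u)`.

The functions `g` exist since `s > 1`: `exp (-x⁻ᵐ)`, `x > 0`, is Gevrey of order `1 + 1 / m` by
Cauchy's estimates. The action of `u` commutes with the integral in the Fourier inversion formula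
because, by Hahn–Banach, `u` extends to a Banach space of bounded functions in which the integral
converges. -/

namespace GelfandShilovWF

/-! ### Factorial estimates -/

theorem pow_le_exp_mul_factorial {σ : ℝ} (hσ : 0 < σ) {R k : ℝ} (hR : 0 ≤ R) (hk : 0 < k) (n : ℕ) :
    R ^ n ≤ Real.exp (σ * (R / k) ^ (1 / σ)) * (k ^ n * (n ! : ℝ) ^ σ) := by
  have hexp : (((R / k) ^ (1 / σ)) ^ n / (n ! : ℝ)) ^ σ ≤ Real.exp ((R / k) ^ (1 / σ)) ^ σ :=
    Real.rpow_le_rpow (by positivity)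
      (Real.pow_div_factorial_le_exp ((R / k) ^ (1 / σ)) (by positivity) n) hσ.le
  have hpow : (((R / k) ^ (1 / σ)) ^ n) ^ σ = (R / k) ^ n := by
    rw [← Real.rpow_natCast, ← Real.rpow_mul (by positivity), ← Real.rpow_mul (by positivity),
      show 1 / σ * ((n : ℝ) * σ) = n by field_simp, Real.rpow_natCast]
  rw [Real.div_rpow (by positivity) (by positivity), hpow, ← Real.exp_mul, div_pow,
    div_le_iff₀ (by positivity), div_le_iff₀ (by positivity), mul_comm _ σ] at hexp
  linarith

theorem exp_mul_le_of_pow_mul_le {s : ℝ} (hs : 0 < s) {R a C ρ : ℝ} (hR : 0 ≤ R) (ha : 0 ≤ a)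
    (hρ : 0 < ρ) (h : ∀ n : ℕ, R ^ n * a ≤ C * (((s / (2 * ρ)) ^ s) ^ n * (n ! : ℝ) ^ s)) :
    Real.exp (ρ * R ^ (1 / s)) * a ≤ 2 ^ s * C := by
  have hC : 0 ≤ C := ha.trans (by simpa using h 0)
  have hs' : s * (1 / s) = 1 := by field_simp
  -- The `(1 / s)`-th powers of the hypotheses are bounds for the terms of the exponential series.
  have hterm (n : ℕ) : (ρ / s * R ^ (1 / s)) ^ n / (n ! : ℝ) * a ^ (1 / s) ≤
      C ^ (1 / s) * (1 / 2) ^ n := by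
    have hroot := Real.rpow_le_rpow (by positivity) (h n) (z := 1 / s) (by positivity)
    rw [Real.mul_rpow (by positivity) ha, Real.mul_rpow hC (by positivity),
      Real.mul_rpow (by positivity) (by positivity), ← Real.rpow_mul (by positivity), hs',
      Real.rpow_one, ← Real.rpow_pow_comm hR, ← Real.rpow_pow_comm (by positivity),
      ← Real.rpow_mul (by positivity), hs', Real.rpow_one] at hroot
    calc (ρ / s * R ^ (1 / s)) ^ n / (n ! : ℝ) * a ^ (1 / s)
        = (ρ / s) ^ n / (n ! : ℝ) * ((R ^ (1 / s)) ^ n * a ^ (1 / s)) := by rw [mul_pow]; ring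
      _ ≤ (ρ / s) ^ n / (n ! : ℝ) * (C ^ (1 / s) * ((s / (2 * ρ)) ^ n * (n ! : ℝ))) := by gcongr
      _ = C ^ (1 / s) * (ρ / s * (s / (2 * ρ))) ^ n := by rw [mul_pow]; field_simp
      _ = C ^ (1 / s) * (1 / 2) ^ n := by congr 2; field_simp
  have hsum : Real.exp (ρ / s * R ^ (1 / s)) * a ^ (1 / s) ≤ C ^ (1 / s) * 2 := by
    have hexp : HasSum (fun n : ℕ => (ρ / s * R ^ (1 / s)) ^ n / (n ! : ℝ))
        (Real.exp (ρ / s * R ^ (1 / s))) := by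
      rw [Real.exp_eq_exp_ℝ]; exact NormedSpace.expSeries_div_hasSum_exp _
    exact hasSum_le hterm (hexp.mul_right _) (hasSum_geometric_two.mul_left _)
  have hpow := Real.rpow_le_rpow (by positivity) hsum hs.le
  rw [Real.mul_rpow (by positivity) (by positivity), Real.mul_rpow (by positivity) (by positivity),
    ← Real.rpow_mul ha, ← Real.rpow_mul hC, mul_comm (1 / s), hs', Real.rpow_one, Real.rpow_one,
    ← Real.exp_mul, show ρ / s * R ^ (1 / s) * s = ρ * R ^ (1 / s) by field_simp] at hpow
  linarith

theorem factorial_rpow_mul_le {s : ℝ} (hs : 0 ≤ s) {i n : ℕ} (hin : i ≤ n) :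
    (i ! : ℝ) ^ s * ((n - i)! : ℝ) ^ s ≤ (n ! : ℝ) ^ s := by
  rw [← Real.mul_rpow (by positivity) (by positivity)]
  refine Real.rpow_le_rpow (by positivity) ?_ hs
  exact_mod_cast Nat.le_of_dvd (Nat.factorial_pos _)
    (Nat.factorial_mul_factorial_dvd_factorial hin)

theorem sum_choose_mul_factorial_rpow_le {s : ℝ} (hs : 0 ≤ s) (n : ℕ) :
    ∑ i ∈ Finset.range (n + 1), (n.choose i : ℝ) * ((i ! : ℝ) ^ s * ((n - i)! : ℝ) ^ s) ≤
      2 ^ n * (n ! : ℝ) ^ s :=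
  calc ∑ i ∈ Finset.range (n + 1), (n.choose i : ℝ) * ((i ! : ℝ) ^ s * ((n - i)! : ℝ) ^ s)
      ≤ ∑ i ∈ Finset.range (n + 1), (n.choose i : ℝ) * (n ! : ℝ) ^ s :=
        Finset.sum_le_sum fun i hi => mul_le_mul_of_nonneg_left
          (factorial_rpow_mul_le hs (Finset.mem_range_succ_iff.mp hi)) (by positivity)
    _ = 2 ^ n * (n ! : ℝ) ^ s := by
        rw [← Finset.sum_mul]
        exact_mod_cast congrArg (fun m : ℕ => (m : ℝ) * (n ! : ℝ) ^ s) (Nat.sum_range_choose n)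

/-! ### Uniform Gevrey estimates -/

section UniformGevrey

variable {X : Type*} [NormedAddCommGroup X] [NormedSpace ℝ X] {s : ℝ}

theorem mul_norm_iteratedFDeriv_mul_le (hs : 0 ≤ s) {f g : X → ℂ}
    (hf : ContDiff ℝ ∞ f) (hg : ContDiff ℝ ∞ g) {A B V k : ℝ} (hk : 0 < k) (hV : 0 ≤ V) {x : X}
    (hA : ∀ n : ℕ, V * ‖iteratedFDeriv ℝ n f x‖ ≤ A * (k ^ n * (n ! : ℝ) ^ s))
    (hB : ∀ n : ℕ, ‖iteratedFDeriv ℝ n g x‖ ≤ B * (k ^ n * (n ! : ℝ) ^ s)) (n : ℕ) :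
    V * ‖iteratedFDeriv ℝ n (fun y => f y * g y) x‖ ≤ A * B * ((2 * k) ^ n * (n ! : ℝ) ^ s) := by
  have hA0 : 0 ≤ A := (by positivity : 0 ≤ V * ‖iteratedFDeriv ℝ 0 f x‖).trans
    (by simpa using hA 0)
  have hB0 : 0 ≤ B := (norm_nonneg _).trans (by simpa using hB 0)
  calc V * ‖iteratedFDeriv ℝ n (fun y => f y * g y) x‖
      ≤ V * ∑ i ∈ Finset.range (n + 1), (n.choose i : ℝ) *
        ‖iteratedFDeriv ℝ i f x‖ * ‖iteratedFDeriv ℝ (n - i) g x‖ :=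
        mul_le_mul_of_nonneg_left (norm_iteratedFDeriv_mul_le hf hg x (n := n)
          (by exact_mod_cast le_top)) hV
    _ ≤ ∑ i ∈ Finset.range (n + 1),
        A * B * k ^ n * ((n.choose i : ℝ) * ((i ! : ℝ) ^ s * ((n - i)! : ℝ) ^ s)) := by
        rw [Finset.mul_sum]
        refine Finset.sum_le_sum fun i hi => ?_
        rw [← pow_mul_pow_sub k (Finset.mem_range_succ_iff.mp hi)]
        calc V * ((n.choose i : ℝ) * ‖iteratedFDeriv ℝ i f x‖ * ‖iteratedFDeriv ℝ (n - i) g x‖)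
            = (n.choose i : ℝ) *
              ((V * ‖iteratedFDeriv ℝ i f x‖) * ‖iteratedFDeriv ℝ (n - i) g x‖) := by ring
          _ ≤ (n.choose i : ℝ) * ((A * (k ^ i * (i ! : ℝ) ^ s)) *
              (B * (k ^ (n - i) * ((n - i)! : ℝ) ^ s))) := by
              exact mul_le_mul_of_nonneg_left (mul_le_mul (hA i) (hB _) (by positivity)
                (by positivity)) (by positivity)
          _ = _ := by ring
    _ ≤ A * B * k ^ n * (2 ^ n * (n ! : ℝ) ^ s) := by
        rw [← Finset.mul_sum]
        gcongr
        exact sum_choose_mul_factorial_rpow_le hs n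
    _ = _ := by rw [mul_pow]; ring

/-- Smooth functions satisfying the Gevrey estimates of order `s` (Beurling type, i.e. for every
`h > 0`) uniformly on the whole space; there is no decay condition. -/
def IsUniformGevrey (s : ℝ) (f : X → ℂ) : Prop :=
  ContDiff ℝ ∞ f ∧ ∀ h : ℝ, 0 < h → ∃ C : ℝ, ∀ (x : X) (n : ℕ),
    ‖iteratedFDeriv ℝ n f x‖ ≤ C * (h ^ n * (n ! : ℝ) ^ s)

namespace IsUniformGevrey

variable {f g : X → ℂ}

theorem const (c : ℂ) : IsUniformGevrey s (fun _ : X => c) := by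
  refine ⟨contDiff_const, fun h hh => ⟨‖c‖, fun x n => ?_⟩⟩
  cases n with
  | zero => simp
  | succ n =>
    simp only [iteratedFDeriv_const_of_ne n.succ_ne_zero, Pi.zero_apply, norm_zero]
    positivity

theorem mul (hs : 0 ≤ s) (hf : IsUniformGevrey s f) (hg : IsUniformGevrey s g) :
    IsUniformGevrey s (fun x => f x * g x) := by
  refine ⟨hf.1.mul hg.1, fun h hh => ?_⟩
  obtain ⟨A, hA⟩ := hf.2 (h / 2) (by positivity)
  obtain ⟨B, hB⟩ := hg.2 (h / 2) (by positivity)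
  refine ⟨A * B, fun x n => ?_⟩
  simpa only [one_mul, mul_div_cancel₀ h two_ne_zero] using
    mul_norm_iteratedFDeriv_mul_le hs hf.1 hg.1 (half_pos hh) zero_le_one (x := x)
      (fun n => (one_mul _).trans_le (hA x n)) (hB x) n

theorem prod (hs : 0 ≤ s) {ι : Type*} (S : Finset ι) {F : ι → X → ℂ}
    (hF : ∀ i, IsUniformGevrey s (F i)) : IsUniformGevrey s (fun x => ∏ i ∈ S, F i x) := by
  classical
  induction S using Finset.induction with
  | empty => simpa only [Finset.prod_empty] using const 1
  | insert i S hi ih =>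
    simp only [Finset.prod_insert hi]
    exact (hF i).mul hs ih

theorem comp_affine {Y : Type*} [NormedAddCommGroup Y] [NormedSpace ℝ Y]
    (hf : IsUniformGevrey s f) (L : Y →L[ℝ] X) (c : X) :
    IsUniformGevrey s (fun y => f (L y + c)) := by
  have hfc : ContDiff ℝ ∞ (fun x => f (x + c)) := hf.1.comp (contDiff_id.add contDiff_const)
  refine ⟨hfc.comp L.contDiff, fun h hh => ?_⟩
  obtain ⟨C, hC⟩ := hf.2 (h / (‖L‖ + 1)) (by positivity)
  refine ⟨C, fun y n => ?_⟩
  have hC0 : 0 ≤ C := by simpa using (norm_nonneg _).trans (hC 0 0)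
  change ‖iteratedFDeriv ℝ n ((fun x => f (x + c)) ∘ L) y‖ ≤ _
  rw [L.iteratedFDeriv_comp_right hfc y (i := n) (by exact_mod_cast le_top),
    iteratedFDeriv_comp_add_right]
  calc _ ≤ ‖iteratedFDeriv ℝ n f (L y + c)‖ * ‖L‖ ^ n := by
        simpa using (iteratedFDeriv ℝ n f (L y + c)).norm_compContinuousLinearMap_le fun _ => L
    _ ≤ C * ((h / (‖L‖ + 1)) ^ n * (n ! : ℝ) ^ s) * (‖L‖ + 1) ^ n := by
        gcongr
        · exact hC _ _
        · linarith
    _ = C * ((h / (‖L‖ + 1) * (‖L‖ + 1)) ^ n * (n ! : ℝ) ^ s) := by rw [mul_pow]; ring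
    _ = _ := by rw [div_mul_cancel₀ _ (by positivity)]

end IsUniformGevrey

end UniformGevrey

theorem IsUniformGevrey.isGevrey {d : ℕ} {s : ℝ} (hs : 0 ≤ s) {f : E d → ℂ}
    (hf : IsUniformGevrey s f) : IsGevrey s f := by
  refine ⟨hf.1, fun K _ h hh => ?_⟩
  obtain ⟨C, hC⟩ := hf.2 (h / ((d : ℝ) + 1) ^ s) (by positivity)
  refine ⟨C, fun x _ β => ?_⟩
  have hC0 : 0 ≤ C := by simpa using (norm_nonneg _).trans (hC 0 0)
  have hβ := multi_le_of_norm hs hf.1 zero_le_one hC0 (k := h / ((d : ℝ) + 1) ^ s)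
    (by positivity) (x := x) (fun n => (one_mul _).trans_le (hC x n)) β
  rwa [one_mul, mul_div_cancel₀ h (by positivity)] at hβ

theorem MemGS.isUniformGevrey {d : ℕ} {t s : ℝ} (hs : 0 ≤ s) {f : E d → ℂ} (hf : MemGS t s f) :
    IsUniformGevrey s f := by
  refine ⟨hf.1, fun h hh => ?_⟩
  obtain ⟨C, hC⟩ := hf.2 (h / ((d : ℝ) + 1)) (by positivity)
  refine ⟨C, fun x n => ?_⟩
  have hn := norm_le_of_multi hs hf.1 zero_le_one (nonneg_of_bound (by positivity) hC)
    (k := h / ((d : ℝ) + 1)) (by positivity) (x := x)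
    (fun β => by simpa [mpow, gsWeight, mlen, mfact] using hC 0 β x) n
  rwa [one_mul, mul_div_cancel₀ h (by positivity)] at hn

/-! ### Compactly supported Gevrey functions -/

/-- The holomorphic function `z ↦ exp (-z⁻ᵐ)` on `ℂ ∖ {0}`, whose restriction to the half-axis
`x > 0` is glued to zero in `expNegInvPowGlue`. -/
noncomputable def expNegInvPow (m : ℕ) (z : ℂ) : ℂ := Complex.exp (-(z ^ m)⁻¹)

theorem differentiableAt_expNegInvPow (m : ℕ) {z : ℂ} (hz : z ≠ 0) :
    DifferentiableAt ℂ (expNegInvPow m) z :=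
  (((differentiableAt_id.pow m).inv (pow_ne_zero m hz)).neg).cexp

theorem exists_re_inv_one_add_pow_ge (m : ℕ) : ∃ c : ℝ, 0 < c ∧ c < 1 ∧
    ∀ w : ℂ, ‖w‖ ≤ c → 1 / 2 ≤ (((1 + w) ^ m)⁻¹).re := by
  have hcont : ContinuousAt (fun w : ℂ => (((1 + w) ^ m)⁻¹).re) 0 := by
    refine Complex.continuous_re.continuousAt.comp ?_
    exact ((continuous_const.add continuous_id).pow m).continuousAt.inv₀ (by simp)
  have hnear : ∀ᶠ w : ℂ in nhds 0, 1 / 2 < (((1 + w) ^ m)⁻¹).re :=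
    hcont.eventually (lt_mem_nhds (by norm_num))
  obtain ⟨ε, hε, h⟩ := Metric.eventually_nhds_iff.mp hnear
  refine ⟨min (ε / 2) (1 / 2), by positivity, (min_le_right _ _).trans_lt (by norm_num),
    fun w hw => (h ?_).le⟩
  rw [dist_zero_right]
  linarith [hw.trans (min_le_left _ _)]

theorem norm_expNegInvPow_le {m : ℕ} {c : ℝ}
    (hc : ∀ w : ℂ, ‖w‖ ≤ c → 1 / 2 ≤ (((1 + w) ^ m)⁻¹).re) {x : ℝ} (hx : 0 < x) {z : ℂ}
    (hz : ‖z - x‖ ≤ c * x) : ‖expNegInvPow m z‖ ≤ Real.exp (-(x⁻¹ ^ m / 2)) := by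
  have hxc : (x : ℂ) ≠ 0 := by exact_mod_cast hx.ne'
  have hw : ‖(z - x) / (x : ℂ)‖ ≤ c := by
    rwa [norm_div, Complex.norm_real, Real.norm_eq_abs, abs_of_pos hx, div_le_iff₀ hx]
  have hscale : (z ^ m)⁻¹ = ((x⁻¹ ^ m : ℝ) : ℂ) * ((1 + (z - x) / x) ^ m)⁻¹ := by
    conv_lhs => rw [show z = x * (1 + (z - x) / x) by field_simp; ring, mul_pow, mul_inv]
    push_cast
    rw [inv_pow]
  rw [expNegInvPow, Complex.norm_exp, Real.exp_le_exp, Complex.neg_re, neg_le_neg_iff, hscale,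
    Complex.re_ofReal_mul]
  nlinarith [hc _ hw, pow_pos (inv_pos.mpr hx) m]

theorem norm_iteratedDeriv_expNegInvPow_le {m : ℕ} {c : ℝ} (hc0 : 0 < c) (hc1 : c < 1)
    (hc : ∀ w : ℂ, ‖w‖ ≤ c → 1 / 2 ≤ (((1 + w) ^ m)⁻¹).re) {x : ℝ} (hx : 0 < x) (n : ℕ) :
    ‖iteratedDeriv n (expNegInvPow m) x‖ ≤
      (n ! : ℝ) * Real.exp (-(x⁻¹ ^ m / 2)) / (c * x) ^ n := by
  have hne : ∀ z ∈ Metric.closedBall (x : ℂ) (c * x), z ≠ 0 := by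
    rintro z hz rfl
    rw [Metric.mem_closedBall, dist_comm, dist_zero_right, Complex.norm_real, Real.norm_eq_abs,
      abs_of_pos hx] at hz
    nlinarith
  have hdiff : DiffContOnCl ℂ (expNegInvPow m) (Metric.ball (x : ℂ) (c * x)) := by
    refine DifferentiableOn.diffContOnCl fun z hz => ?_
    rw [closure_ball _ (by positivity)] at hz
    exact (differentiableAt_expNegInvPow m (hne z hz)).differentiableWithinAt
  exact Complex.norm_iteratedDeriv_le_of_forall_mem_sphere_norm_le n (by positivity) hdiff
    fun z hz => norm_expNegInvPow_le hc hx (mem_sphere_iff_norm.mp hz).le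

theorem inv_pow_mul_exp_le {m : ℕ} (hm : 0 < m) {x : ℝ} (hx : 0 < x) (n : ℕ) :
    x⁻¹ ^ n * Real.exp (-(x⁻¹ ^ m / 2)) ≤
      ((2 / m : ℝ) ^ (1 / (m : ℝ))) ^ n * (n ! : ℝ) ^ (1 / (m : ℝ)) := by
  have hm' : (0 : ℝ) < m := by exact_mod_cast hm
  have hpow := pow_le_exp_mul_factorial (σ := 1 / (m : ℝ)) (by positivity) (R := x⁻¹)
    (by positivity) (k := (2 / m : ℝ) ^ (1 / (m : ℝ))) (by positivity) n
  have hexponent : 1 / (m : ℝ) * (x⁻¹ / (2 / m : ℝ) ^ (1 / (m : ℝ))) ^ (1 / (1 / (m : ℝ))) =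
      x⁻¹ ^ m / 2 := by
    rw [one_div_one_div, Real.rpow_natCast, div_pow, ← Real.rpow_natCast (_ ^ _),
      ← Real.rpow_mul (by positivity), one_div_mul_cancel hm'.ne', Real.rpow_one]
    field_simp
  rwa [hexponent, ← div_le_iff₀' (Real.exp_pos _), div_eq_mul_inv, ← Real.exp_neg] at hpow

theorem exists_norm_iteratedDeriv_expNegInvPow_le {m : ℕ} (hm : 0 < m) :
    ∃ k : ℝ, 0 < k ∧ ∀ x : ℝ, 0 < x → ∀ n : ℕ,
      ‖iteratedDeriv n (expNegInvPow m) x‖ ≤ k ^ n * (n ! : ℝ) ^ (1 + 1 / (m : ℝ)) := by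
  obtain ⟨c, hc0, hc1, hc⟩ := exists_re_inv_one_add_pow_ge m
  refine ⟨(2 / m : ℝ) ^ (1 / (m : ℝ)) / c, by positivity, fun x hx n => ?_⟩
  calc ‖iteratedDeriv n (expNegInvPow m) x‖
      ≤ (n ! : ℝ) * Real.exp (-(x⁻¹ ^ m / 2)) / (c * x) ^ n :=
        norm_iteratedDeriv_expNegInvPow_le hc0 hc1 hc hx n
    _ = (n ! : ℝ) / c ^ n * (x⁻¹ ^ n * Real.exp (-(x⁻¹ ^ m / 2))) := by
        rw [mul_pow, inv_pow x n]; field_simp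
    _ ≤ (n ! : ℝ) / c ^ n *
        (((2 / m : ℝ) ^ (1 / (m : ℝ))) ^ n * (n ! : ℝ) ^ (1 / (m : ℝ))) := by
        gcongr ?_ * ?_
        exact inv_pow_mul_exp_le hm hx n
    _ = _ := by rw [Real.rpow_add (by positivity), Real.rpow_one, div_pow]; ring

/-- The function equal to `exp (-x⁻ᵐ)` for `x > 0` and, if `m` is odd, to zero for `x ≤ 0`. It is
smooth on `ℝ`, and Gevrey of every order larger than `1 + 1 / m`. -/
noncomputable def expNegInvPowGlue (m : ℕ) (x : ℝ) : ℂ := (expNegInvGlue (x ^ m) : ℂ)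

theorem contDiff_expNegInvPowGlue (m : ℕ) : ContDiff ℝ ∞ (expNegInvPowGlue m) :=
  Complex.ofRealCLM.contDiff.comp (expNegInvGlue.contDiff.comp (contDiff_id.pow m))

theorem expNegInvPowGlue_of_nonpos {m : ℕ} (hm : Odd m) {x : ℝ} (hx : x ≤ 0) :
    expNegInvPowGlue m x = 0 := by
  rw [expNegInvPowGlue, expNegInvGlue.zero_of_nonpos (hm.pow_nonpos hx), Complex.ofReal_zero]

theorem expNegInvPowGlue_ne_zero (m : ℕ) {x : ℝ} (hx : 0 < x) : expNegInvPowGlue m x ≠ 0 := by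
  rw [expNegInvPowGlue, Complex.ofReal_ne_zero]
  exact (expNegInvGlue.pos_of_pos (pow_pos hx m)).ne'

theorem iteratedDeriv_expNegInvPowGlue (m n : ℕ) {x : ℝ} (hx : 0 < x) :
    iteratedDeriv n (expNegInvPowGlue m) x = iteratedDeriv n (expNegInvPow m) x := by
  induction n generalizing x with
  | zero =>
    simp only [iteratedDeriv_zero, expNegInvPowGlue, expNegInvPow, expNegInvGlue]
    rw [if_neg (not_le.mpr (pow_pos hx m))]
    push_cast
    rfl
  | succ n ih =>
    have hxc : (x : ℂ) ≠ 0 := by exact_mod_cast hx.ne'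
    have hanalytic : AnalyticAt ℂ (expNegInvPow m) x :=
      (DifferentiableOn.analyticOnNhd (s := {0}ᶜ)
        (fun z hz => (differentiableAt_expNegInvPow m hz).differentiableWithinAt)
        isOpen_compl_singleton) _ hxc
    have hdiff : DifferentiableAt ℂ (iteratedDeriv n (expNegInvPow m)) x := by
      rw [iteratedDeriv_eq_iterate]; exact (hanalytic.iterated_deriv n).differentiableAt
    rw [iteratedDeriv_succ, iteratedDeriv_succ, ← hdiff.hasDerivAt.comp_ofReal.deriv]
    apply Filter.EventuallyEq.deriv_eq
    filter_upwards [lt_mem_nhds hx] with y hy using ih hy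

theorem iteratedDeriv_expNegInvPowGlue_of_nonpos {m : ℕ} (hm : Odd m) (n : ℕ) {x : ℝ}
    (hx : x ≤ 0) : iteratedDeriv n (expNegInvPowGlue m) x = 0 := by
  have hneg : Set.EqOn (iteratedDeriv n (expNegInvPowGlue m)) 0 (Set.Iio 0) := by
    intro y hy
    have hzero : expNegInvPowGlue m =ᶠ[nhds y] fun _ => 0 := by
      filter_upwards [gt_mem_nhds hy] with z hz using expNegInvPowGlue_of_nonpos hm hz.le
    rw [hzero.iteratedDeriv_eq, iteratedDeriv_fun_const_zero, Pi.zero_apply]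
  have hclosure := hneg.closure ((contDiff_expNegInvPowGlue m).continuous_iteratedDeriv n
    (by exact_mod_cast le_top)) continuous_const
  exact hclosure (by rwa [closure_Iio])

theorem isUniformGevrey_expNegInvPowGlue {m : ℕ} (hm : Odd m) {s : ℝ} (hs : 1 + 1 / (m : ℝ) < s) :
    IsUniformGevrey s (expNegInvPowGlue m) := by
  refine ⟨contDiff_expNegInvPowGlue m, fun h hh => ?_⟩
  obtain ⟨k, hk, hbound⟩ := exists_norm_iteratedDeriv_expNegInvPow_le hm.pos
  obtain ⟨C, _, hC⟩ := exists_pow_le (sub_pos.mpr hs) k hk.le hh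
  refine ⟨C, fun x n => ?_⟩
  rw [norm_iteratedFDeriv_eq_norm_iteratedDeriv]
  rcases le_or_gt x 0 with hx | hx
  · rw [iteratedDeriv_expNegInvPowGlue_of_nonpos hm n hx, norm_zero]
    positivity
  · rw [iteratedDeriv_expNegInvPowGlue m n hx]
    calc ‖iteratedDeriv n (expNegInvPow m) x‖
        ≤ k ^ n * (n ! : ℝ) ^ (1 + 1 / (m : ℝ)) := hbound x hx n
      _ ≤ C * (h ^ n * (n ! : ℝ) ^ (s - (1 + 1 / (m : ℝ)))) *
          (n ! : ℝ) ^ (1 + 1 / (m : ℝ)) := by gcongr; exact hC n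
      _ = C * (h ^ n * ((n ! : ℝ) ^ (s - (1 + 1 / (m : ℝ))) *
          (n ! : ℝ) ^ (1 + 1 / (m : ℝ)))) := by ring
      _ = _ := by rw [← Real.rpow_add (by positivity), sub_add_cancel]

theorem exists_isUniformGevrey_eq_zero_iff {s : ℝ} (hs : 1 < s) :
    ∃ f : ℝ → ℂ, IsUniformGevrey s f ∧ ∀ x, f x = 0 ↔ x ≤ 0 := by
  obtain ⟨N, hN⟩ := exists_nat_gt (1 / (s - 1))
  have hm : Odd (2 * N + 1) := ⟨N, rfl⟩
  have hms : 1 + 1 / ((2 * N + 1 : ℕ) : ℝ) < s := by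
    have hlarge : 1 / (s - 1) < ((2 * N + 1 : ℕ) : ℝ) :=
      hN.trans_le (by exact_mod_cast (by omega : N ≤ 2 * N + 1))
    linarith [(div_lt_comm₀ (sub_pos.mpr hs) (by positivity)).mp hlarge]
  refine ⟨expNegInvPowGlue (2 * N + 1), isUniformGevrey_expNegInvPowGlue hm hms, fun x =>
    ⟨fun hx => ?_, expNegInvPowGlue_of_nonpos hm⟩⟩
  by_contra! h
  exact expNegInvPowGlue_ne_zero _ h hx

theorem exists_isUniformGevrey_hasCompactSupport_ne_zero {X : Type*} [NormedAddCommGroup X]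
    [NormedSpace ℝ X] [FiniteDimensional ℝ X] {s : ℝ} (hs : 1 < s) (x₀ : X) :
    ∃ g : X → ℂ, IsUniformGevrey s g ∧ HasCompactSupport g ∧ g x₀ ≠ 0 := by
  obtain ⟨f, hf, hzero⟩ := exists_isUniformGevrey_eq_zero_iff hs
  have hs0 : 0 ≤ s := by linarith
  let e := (Module.finBasis ℝ X).equivFunL
  let L (j : Fin (Module.finrank ℝ X)) : X →L[ℝ] ℝ :=
    (ContinuousLinearMap.proj j).comp e.toContinuousLinearMap
  refine ⟨fun y => ∏ j, (f (L j y + (1 - L j x₀)) * f ((-L j) y + (1 + L j x₀))), ?_, ?_, ?_⟩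
  · exact IsUniformGevrey.prod hs0 _ fun j =>
      (hf.comp_affine (L j) _).mul hs0 (hf.comp_affine (-L j) _)
  · refine HasCompactSupport.of_support_subset_isCompact
      (e.toHomeomorph.isCompact_preimage.mpr (isCompact_Icc (a := e x₀ - 1) (b := e x₀ + 1)))
      fun y hy => ?_
    simp only [Function.mem_support, Finset.prod_ne_zero_iff, mul_ne_zero_iff, ne_eq, hzero,
      not_le, Finset.mem_univ, true_imp_iff, neg_apply] at hy
    refine ⟨fun j => ?_, fun j => ?_⟩
    · change L j x₀ - 1 ≤ L j y
      linarith [(hy j).1]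
    · change L j y ≤ L j x₀ + 1
      linarith [(hy j).2]
  · simp [hzero]

/-! ### Gevrey decay and Fourier transforms -/

/-- Decay on `Γ` of order `e^{-r|ξ|^{1/s}}` for every `r > 0`, as in the definition of the Gevrey
wave front set. -/
def HasGevreyDecayOn {F : Type*} [Norm F] (s : ℝ) (V : F → ℂ) (Γ : Set F) : Prop :=
  ∀ r : ℝ, 0 < r → ∃ C : ℝ, ∀ ξ ∈ Γ, Real.exp (r * ‖ξ‖ ^ (1 / s)) * ‖V ξ‖ ≤ C

/-- Growth of order `e^{r|ξ|^{1/s}}` for some `r ≥ 0`, as satisfied by the Fourier transforms of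
compactly supported ultradistributions. -/
def HasGevreyGrowth {F : Type*} [Norm F] (s : ℝ) (V : F → ℂ) : Prop :=
  ∃ C r : ℝ, 0 ≤ r ∧ ∀ ξ, ‖V ξ‖ ≤ C * Real.exp (r * ‖ξ‖ ^ (1 / s))

section Fourier

open FourierTransform MeasureTheory

variable {X : Type*} [NormedAddCommGroup X] [InnerProductSpace ℝ X] [FiniteDimensional ℝ X]
  [MeasurableSpace X] [BorelSpace X] {s : ℝ} {g : X → ℂ}

theorem continuous_fourier (hg : Integrable g) : Continuous (𝓕 g) :=
  VectorFourier.fourierIntegral_continuous Real.continuous_fourierChar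
    (by exact continuous_inner) hg

theorem pow_mul_norm_fourier_le (hg : ContDiff ℝ ∞ g)
    (hint : ∀ n : ℕ, Integrable (iteratedFDeriv ℝ n g)) (n : ℕ) (w : X) :
    (2 * Real.pi * ‖w‖) ^ n * ‖𝓕 g w‖ ≤ ∫ v, ‖iteratedFDeriv ℝ n g v‖ := by
  have hfourier := congrFun (Real.fourier_iteratedFDeriv (N := ⊤) hg (fun n _ => hint n)
    (n := n) le_top) w
  obtain ⟨e, hwe, he⟩ : ∃ e : X, innerSL ℝ w e = ‖w‖ ∧ ‖e‖ ≤ 1 := by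
    refine ⟨‖w‖⁻¹ • w, ?_, ?_⟩
    · rw [innerSL_apply_apply, real_inner_smul_right, real_inner_self_eq_norm_mul_norm,
        ← mul_assoc, inv_mul_mul_self]
    · rw [norm_smul, norm_inv, norm_norm]
      exact inv_mul_le_one
  calc (2 * Real.pi * ‖w‖) ^ n * ‖𝓕 g w‖
      = ‖𝓕 (iteratedFDeriv ℝ n g) w fun _ => e‖ := by
        rw [hfourier, VectorFourier.fourierPowSMulRight_apply]
        simp [hwe, abs_of_pos Real.pi_pos, mul_pow, mul_assoc]
    _ ≤ ‖𝓕 (iteratedFDeriv ℝ n g) w‖ := by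
        refine (ContinuousMultilinearMap.le_opNorm _ _).trans
          (mul_le_of_le_one_right (norm_nonneg _) ?_)
        exact Finset.prod_le_one (fun _ _ => norm_nonneg _) fun _ _ => he
    _ ≤ ∫ v, ‖iteratedFDeriv ℝ n g v‖ :=
        VectorFourier.norm_fourierIntegral_le_integral_norm _ _ _ _ _

theorem integral_norm_iteratedFDeriv_le (hgc : HasCompactSupport g) {n : ℕ} {B : ℝ}
    (hB : ∀ v, ‖iteratedFDeriv ℝ n g v‖ ≤ B) :
    ∫ v, ‖iteratedFDeriv ℝ n g v‖ ≤ B * volume.real (tsupport g) := by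
  have hzero (v : X) (hv : v ∉ tsupport g) : ‖iteratedFDeriv ℝ n g v‖ = 0 := by
    rw [norm_eq_zero]
    exact Function.notMem_support.mp fun h => hv (support_iteratedFDeriv_subset (𝕜 := ℝ) n h)
  rw [← setIntegral_eq_integral_of_forall_compl_eq_zero hzero]
  exact (le_abs_self _).trans (norm_setIntegral_le_of_norm_le_const (f := fun v =>
    ‖iteratedFDeriv ℝ n g v‖) hgc.isCompact.measure_lt_top fun v _ => (norm_norm _).trans_le (hB v))

theorem IsUniformGevrey.hasGevreyDecayOn_fourier (hs : 0 < s) (hg : IsUniformGevrey s g)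
    (hgc : HasCompactSupport g) : HasGevreyDecayOn s (𝓕 g) Set.univ := by
  intro r hr
  obtain ⟨C, hC⟩ := hg.2 ((s / (2 * r)) ^ s) (by positivity)
  refine ⟨2 ^ s * (C * volume.real (tsupport g)), fun w _ => ?_⟩
  have hint (n : ℕ) : Integrable (iteratedFDeriv ℝ n g) :=
    (hg.1.continuous_iteratedFDeriv (by exact_mod_cast le_top)).integrable_of_hasCompactSupport
      (hgc.iteratedFDeriv n)
  have hpow (n : ℕ) : ‖w‖ ^ n * ‖𝓕 g w‖ ≤
      C * volume.real (tsupport g) * (((s / (2 * r)) ^ s) ^ n * (n ! : ℝ) ^ s) :=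
    calc ‖w‖ ^ n * ‖𝓕 g w‖ ≤ (2 * Real.pi * ‖w‖) ^ n * ‖𝓕 g w‖ := by
          gcongr
          exact le_mul_of_one_le_left (norm_nonneg _) (by linarith [Real.two_le_pi])
      _ ≤ ∫ v, ‖iteratedFDeriv ℝ n g v‖ := pow_mul_norm_fourier_le hg.1 hint n w
      _ ≤ _ := integral_norm_iteratedFDeriv_le hgc fun v => hC v n
      _ = _ := by ring
  exact exp_mul_le_of_pow_mul_le hs (norm_nonneg w) (norm_nonneg _) hr hpow

end Fourier

section GevreyGrowth

variable {F : Type*} [NormedAddCommGroup F] {s : ℝ} {V K : F → ℂ} {Γ : Set F}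

theorem norm_add_rpow_one_div_le (hs : 1 ≤ s) (ξ η : F) :
    ‖ξ + η‖ ^ (1 / s) ≤ ‖ξ‖ ^ (1 / s) + ‖η‖ ^ (1 / s) :=
  (Real.rpow_le_rpow (norm_nonneg _) (norm_add_le ξ η) (by positivity)).trans
    (Real.rpow_add_le_add_rpow (norm_nonneg _) (norm_nonneg _) (by positivity)
      ((div_le_one (by linarith)).mpr hs))

theorem HasGevreyGrowth.hasGevreyDecayOn (hs : 0 < s) (hV : HasGevreyGrowth s V) {R : ℝ}
    (h : HasGevreyDecayOn s V {ξ ∈ Γ | R < ‖ξ‖}) : HasGevreyDecayOn s V Γ := by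
  intro r hr
  obtain ⟨C, hC⟩ := h r hr
  obtain ⟨C₁, r₁, hr₁, hV⟩ := hV
  have hC₁ : 0 ≤ C₁ := nonneg_of_mul_nonneg_left ((norm_nonneg _).trans (hV 0)) (Real.exp_pos _)
  refine ⟨max C (Real.exp (r * R ^ (1 / s)) * (C₁ * Real.exp (r₁ * R ^ (1 / s)))),
    fun ξ hξ => ?_⟩
  rcases lt_or_ge R ‖ξ‖ with hR | hR
  · exact le_max_of_le_left (hC ξ ⟨hξ, hR⟩)
  · refine le_max_of_le_right ?_
    gcongr
    exact (hV ξ).trans (by gcongr)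

open MeasureTheory in
theorem HasGevreyDecayOn.integrable_exp_mul [NormedSpace ℝ F] [FiniteDimensional ℝ F]
    [MeasurableSpace F] [BorelSpace F] {μ : Measure F} [μ.IsAddHaarMeasure] (hs : 1 ≤ s)
    (hK : HasGevreyDecayOn s K Set.univ) (hKm : AEStronglyMeasurable K μ) (M : ℝ) :
    Integrable (fun w => Real.exp (M * ‖w‖ ^ (1 / s)) * ‖K w‖) μ := by
  have hs0 : 0 < s := by linarith
  obtain ⟨C, hC⟩ := hK (|M| + s) (by positivity)
  set n := Module.finrank ℝ F + 1
  have hcont : Continuous fun w : F => Real.exp (M * ‖w‖ ^ (1 / s)) :=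
    Real.continuous_exp.comp
      (continuous_const.mul (continuous_norm.rpow_const fun _ => Or.inr (by positivity)))
  refine Integrable.mono' ((integrable_one_add_norm (μ := μ) (r := (n : ℝ))
    (by simp [n])).const_mul (Real.exp s * (n ! : ℝ) ^ s * C))
    (hcont.aestronglyMeasurable.mul hKm.norm) (Filter.Eventually.of_forall fun w => ?_)
  have hpow : (1 + ‖w‖) ^ n ≤ Real.exp s * (n ! : ℝ) ^ s * Real.exp (s * ‖w‖ ^ (1 / s)) :=
    calc (1 + ‖w‖) ^ n ≤ Real.exp (s * (1 + ‖w‖) ^ (1 / s)) * (n ! : ℝ) ^ s := by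
          simpa using pow_le_exp_mul_factorial hs0 (R := 1 + ‖w‖) (by positivity) one_pos n
      _ ≤ Real.exp (s * (1 + ‖w‖ ^ (1 / s))) * (n ! : ℝ) ^ s := by
          have := Real.rpow_add_le_add_rpow zero_le_one (norm_nonneg w) (p := 1 / s)
            (by positivity) ((div_le_one hs0).mpr hs)
          rw [Real.one_rpow] at this
          gcongr
      _ = _ := by rw [mul_add, Real.exp_add, mul_one]; ring
  rw [Real.norm_of_nonneg (by positivity), Real.rpow_neg (by positivity), Real.rpow_natCast,
    ← div_eq_mul_inv, le_div_iff₀ (by positivity)]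
  calc Real.exp (M * ‖w‖ ^ (1 / s)) * ‖K w‖ * (1 + ‖w‖) ^ n
      ≤ Real.exp (|M| * ‖w‖ ^ (1 / s)) * ‖K w‖ *
        (Real.exp s * (n ! : ℝ) ^ s * Real.exp (s * ‖w‖ ^ (1 / s))) := by
        gcongr
        exact le_abs_self M
    _ = Real.exp s * (n ! : ℝ) ^ s * (Real.exp ((|M| + s) * ‖w‖ ^ (1 / s)) * ‖K w‖) := by
        rw [add_mul, Real.exp_add]; ring
    _ ≤ _ := by gcongr; exact hC w (Set.mem_univ w)

end GevreyGrowth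

section Cone

variable {F : Type*} [NormedAddCommGroup F] [NormedSpace ℝ F]

/-- The cone of all vectors with a positive multiple at distance less than `ε` from `ξ₀`; these
cones form a basis of the open conic neighbourhoods of `ξ₀ ≠ 0`. -/
def coneAbout (ξ₀ : F) (ε : ℝ) : Set F := {ξ | ∃ l : ℝ, 0 < l ∧ ‖l • ξ - ξ₀‖ < ε}

theorem isOpen_coneAbout (ξ₀ : F) (ε : ℝ) : IsOpen (coneAbout ξ₀ ε) := by
  have hunion : coneAbout ξ₀ ε = ⋃ l : Set.Ioi (0 : ℝ), {ξ : F | ‖l.1 • ξ - ξ₀‖ < ε} := by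
    ext ξ
    simp [coneAbout]
  rw [hunion]
  exact isOpen_iUnion fun l => isOpen_lt (by fun_prop) continuous_const

theorem smul_mem_coneAbout {ξ₀ : F} {ε : ℝ} {l : ℝ} (hl : 0 < l) {ξ : F}
    (hξ : ξ ∈ coneAbout ξ₀ ε) : l • ξ ∈ coneAbout ξ₀ ε := by
  obtain ⟨m, hm, h⟩ := hξ
  refine ⟨m / l, by positivity, ?_⟩
  rwa [smul_smul, div_mul_cancel₀ _ hl.ne']

theorem zero_notMem_coneAbout {ξ₀ : F} {ε : ℝ} (hε : ε ≤ ‖ξ₀‖) : (0 : F) ∉ coneAbout ξ₀ ε := by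
  rintro ⟨l, -, h⟩
  rw [smul_zero, zero_sub, norm_neg] at h
  linarith

theorem self_mem_coneAbout (ξ₀ : F) {ε : ℝ} (hε : 0 < ε) : ξ₀ ∈ coneAbout ξ₀ ε :=
  ⟨1, one_pos, by simpa using hε⟩

theorem mul_norm_le_of_norm_sub_lt {ξ ξ₀ : F} {ε l : ℝ} (hl : 0 < l) (hε : ε ≤ ‖ξ₀‖)
    (h : ‖l • ξ - ξ₀‖ < ε) : l * ‖ξ‖ ≤ 2 * ‖ξ₀‖ := by
  have hnorm := norm_sub_norm_le (l • ξ) ξ₀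
  rw [norm_smul, Real.norm_of_nonneg hl.le] at hnorm
  linarith

theorem sub_mem_coneAbout {ξ₀ ξ η : F} {ε : ℝ} (hε : 0 < ε) (hεξ : ε ≤ ‖ξ₀‖)
    (hξ : ξ ∈ coneAbout ξ₀ (ε / 2)) (hη : ‖η‖ ≤ ε / (4 * ‖ξ₀‖) * ‖ξ‖) :
    ξ - η ∈ coneAbout ξ₀ ε := by
  obtain ⟨l, hl, hlξ⟩ := hξ
  have hξ₀ : 0 < ‖ξ₀‖ := hε.trans_le hεξ
  have hlη : ‖l • η‖ ≤ ε / 2 :=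
    calc ‖l • η‖ = l * ‖η‖ := by rw [norm_smul, Real.norm_of_nonneg hl.le]
      _ ≤ l * (ε / (4 * ‖ξ₀‖) * ‖ξ‖) := by gcongr
      _ = ε / (4 * ‖ξ₀‖) * (l * ‖ξ‖) := by ring
      _ ≤ ε / (4 * ‖ξ₀‖) * (2 * ‖ξ₀‖) :=
          mul_le_mul_of_nonneg_left (mul_norm_le_of_norm_sub_lt hl (by linarith) hlξ)
            (by positivity)
      _ = ε / 2 := by field_simp; norm_num
  refine ⟨l, hl, ?_⟩
  calc ‖l • (ξ - η) - ξ₀‖ = ‖(l • ξ - ξ₀) - l • η‖ := by rw [smul_sub, sub_right_comm]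
    _ ≤ ‖l • ξ - ξ₀‖ + ‖l • η‖ := norm_sub_le _ _
    _ < ε := by linarith

end Cone

section Convolution

variable {F : Type*} [NormedAddCommGroup F] {s δ : ℝ} {V K : F → ℂ} {Γ Γ' : Set F}

theorem HasGevreyDecayOn.exists_exp_mul_norm_sub_le (hs : 1 ≤ s) (hV : HasGevreyGrowth s V)
    (hVΓ : HasGevreyDecayOn s V Γ) (hδ : 0 < δ)
    (hΓ : ∀ ξ ∈ Γ', ∀ η, ‖η‖ ≤ δ * ‖ξ‖ → ξ - η ∈ Γ) {r : ℝ} (hr : 0 < r) :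
    ∃ C M : ℝ, ∀ ξ ∈ Γ', ∀ η,
      Real.exp (r * ‖ξ‖ ^ (1 / s)) * ‖V (ξ - η)‖ ≤ C * Real.exp (M * ‖η‖ ^ (1 / s)) := by
  obtain ⟨C, hC⟩ := hVΓ r hr
  obtain ⟨C₁, r₁, hr₁, hV⟩ := hV
  have hC₁ : 0 ≤ C₁ := nonneg_of_mul_nonneg_left ((norm_nonneg _).trans (hV 0)) (Real.exp_pos _)
  set L : ℝ := δ⁻¹ ^ (1 / s)
  have hL : 0 ≤ L := by positivity
  refine ⟨max C C₁, (r + r₁) * (L + 1), fun ξ hξ η => ?_⟩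
  rcases le_or_gt ‖η‖ (δ * ‖ξ‖) with hη | hη
  · have htriangle : ‖ξ‖ ^ (1 / s) ≤ ‖ξ - η‖ ^ (1 / s) + ‖η‖ ^ (1 / s) := by
      simpa only [sub_add_cancel] using norm_add_rpow_one_div_le hs (ξ - η) η
    calc Real.exp (r * ‖ξ‖ ^ (1 / s)) * ‖V (ξ - η)‖
        ≤ Real.exp (r * (‖ξ - η‖ ^ (1 / s) + ‖η‖ ^ (1 / s))) * ‖V (ξ - η)‖ := by gcongr
      _ = Real.exp (r * ‖ξ - η‖ ^ (1 / s)) * ‖V (ξ - η)‖ * Real.exp (r * ‖η‖ ^ (1 / s)) := by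
          rw [mul_add, Real.exp_add]; ring
      _ ≤ _ := by
          gcongr
          · exact (hC _ (hΓ ξ hξ η hη)).trans (le_max_left _ _)
          · nlinarith
  · have hξη : ‖ξ‖ ^ (1 / s) ≤ L * ‖η‖ ^ (1 / s) := by
      rw [← Real.mul_rpow (by positivity) (norm_nonneg _)]
      refine Real.rpow_le_rpow (norm_nonneg _) ?_ (by positivity)
      rw [inv_mul_eq_div, le_div_iff₀' hδ]
      exact hη.le
    have hsub : ‖ξ - η‖ ^ (1 / s) ≤ (L + 1) * ‖η‖ ^ (1 / s) := by
      have := norm_add_rpow_one_div_le hs ξ (-η)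
      rw [norm_neg, ← sub_eq_add_neg] at this
      linarith
    calc Real.exp (r * ‖ξ‖ ^ (1 / s)) * ‖V (ξ - η)‖
        ≤ Real.exp (r * ((L + 1) * ‖η‖ ^ (1 / s))) *
          (C₁ * Real.exp (r₁ * ((L + 1) * ‖η‖ ^ (1 / s)))) := by
          gcongr
          · linarith [Real.rpow_nonneg (norm_nonneg η) (1 / s)]
          · exact (hV _).trans (by gcongr)
      _ = C₁ * Real.exp ((r + r₁) * (L + 1) * ‖η‖ ^ (1 / s)) := by
          rw [mul_left_comm, ← Real.exp_add]; ring_nf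
      _ ≤ _ := by gcongr; exact le_max_right _ _

open MeasureTheory

theorem HasGevreyDecayOn.integral_mul_sub_smul [NormedSpace ℝ F] [FiniteDimensional ℝ F]
    [MeasurableSpace F] [BorelSpace F] {μ : Measure F} [μ.IsAddHaarMeasure] (hs : 1 ≤ s)
    (hK : HasGevreyDecayOn s K Set.univ) (hKm : AEStronglyMeasurable K μ)
    (hV : HasGevreyGrowth s V) (hVΓ : HasGevreyDecayOn s V Γ) (hδ : 0 < δ)
    (hΓ : ∀ ξ ∈ Γ', ∀ η, ‖η‖ ≤ δ * ‖ξ‖ → ξ - η ∈ Γ) (c : ℝ) :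
    HasGevreyDecayOn s (fun ξ => ∫ w, K w * V (ξ - c • w) ∂μ) Γ' := by
  intro r hr
  obtain ⟨C, M, hC⟩ := hVΓ.exists_exp_mul_norm_sub_le hs hV hδ hΓ hr
  refine ⟨∫ w, C * (Real.exp (M * |c| ^ (1 / s) * ‖w‖ ^ (1 / s)) * ‖K w‖) ∂μ, fun ξ hξ => ?_⟩
  have hnorm : Real.exp (r * ‖ξ‖ ^ (1 / s)) * ‖∫ w, K w * V (ξ - c • w) ∂μ‖ =
      ‖∫ w, (Real.exp (r * ‖ξ‖ ^ (1 / s)) : ℂ) * (K w * V (ξ - c • w)) ∂μ‖ := by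
    rw [integral_const_mul, norm_mul, Complex.norm_real, Real.norm_of_nonneg (Real.exp_pos _).le]
  rw [hnorm]
  refine norm_integral_le_of_norm_le ((hK.integrable_exp_mul hs hKm _).const_mul C)
    (Filter.Eventually.of_forall fun w => ?_)
  rw [norm_mul, norm_mul, Complex.norm_real, Real.norm_of_nonneg (Real.exp_pos _).le]
  calc Real.exp (r * ‖ξ‖ ^ (1 / s)) * (‖K w‖ * ‖V (ξ - c • w)‖)
      = Real.exp (r * ‖ξ‖ ^ (1 / s)) * ‖V (ξ - c • w)‖ * ‖K w‖ := by ring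
    _ ≤ C * Real.exp (M * ‖c • w‖ ^ (1 / s)) * ‖K w‖ :=
        mul_le_mul_of_nonneg_right (hC ξ hξ _) (norm_nonneg _)
    _ = _ := by
        rw [norm_smul, Real.norm_eq_abs, Real.mul_rpow (abs_nonneg c) (norm_nonneg w)]; ring_nf

end Convolution

/-! ### Multiplication and modulation in Gelfand–Shilov spaces -/

section MultiIndex

variable {d : ℕ} {t s : ℝ}

theorem mpow_add_single (x : E d) (α : Fin d → ℕ) (j : Fin d) :
    mpow x (α + Pi.single j 1) = mpow x α * x j := by
  simp only [mpow, Pi.add_apply, pow_add, Finset.prod_mul_distrib]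
  congr 1
  rw [Finset.prod_eq_single j] <;> simp +contextual

theorem mlen_add_single (α : Fin d → ℕ) (j : Fin d) : mlen (α + Pi.single j 1) = mlen α + 1 := by
  simp [mlen, Finset.sum_add_distrib]

theorem mfact_add_single (α : Fin d → ℕ) (j : Fin d) :
    mfact (α + Pi.single j 1) = (α j + 1) * mfact α := by
  unfold mfact
  rw [← Finset.mul_prod_erase _ _ (Finset.mem_univ j),
    ← Finset.mul_prod_erase Finset.univ (fun i => (α i)!) (Finset.mem_univ j), ← mul_assoc]
  congr 1
  · simp [Nat.factorial_succ]
  · refine Finset.prod_congr rfl fun i hi => ?_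
    simp [Finset.ne_of_mem_erase hi]

theorem gsWeight_add_single_le (ht : 0 ≤ t) {k : ℝ} (hk : 0 ≤ k) (α β : Fin d → ℕ) (j : Fin d) :
    gsWeight t s k (α + Pi.single j 1) β ≤ k * gsWeight t s (2 ^ t * k) α β := by
  have hα := mfact_pos α
  have hβ := mfact_pos β
  have hcoord : ((α j + 1 : ℕ) : ℝ) ≤ 2 ^ mlen α := by
    have hle : α j ≤ mlen α := Finset.single_le_sum (f := α) (fun _ _ => Nat.zero_le _)
      (Finset.mem_univ j)
    exact_mod_cast (Nat.succ_le_succ hle).trans Nat.lt_two_pow_self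
  have hcoord_rpow : ((α j + 1 : ℕ) : ℝ) ^ t ≤ (2 ^ t) ^ mlen α :=
    (Real.rpow_le_rpow (by positivity) hcoord ht).trans_eq (Real.rpow_pow_comm zero_le_two _ _).symm
  have hk2 : k ≤ 2 ^ t * k := le_mul_of_one_le_left hk (Real.one_le_rpow one_le_two ht)
  rw [gsWeight_split, gsWeight_split, mlen_add_single, mfact_add_single, Nat.cast_mul,
    Real.mul_rpow (by positivity) hα.le]
  calc k ^ (mlen α + 1) * (((α j + 1 : ℕ) : ℝ) ^ t * (mfact α : ℝ) ^ t) *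
        (k ^ mlen β * (mfact β : ℝ) ^ s)
      ≤ k ^ (mlen α + 1) * ((2 ^ t) ^ mlen α * (mfact α : ℝ) ^ t) *
        ((2 ^ t * k) ^ mlen β * (mfact β : ℝ) ^ s) := by gcongr
    _ = _ := by rw [mul_pow _ _ (mlen α), pow_succ]; ring

theorem exists_one_add_norm_mul_le (ht : 0 ≤ t) {f : E d → ℂ} (hf : MemGS t s f) {k : ℝ}
    (hk : 0 < k) : ∃ B : ℝ, ∀ (α β : Fin d → ℕ) (x : E d),
      (1 + ‖x‖) * |mpow x α| * ‖mderiv β f x‖ ≤ B * gsWeight t s k α β := by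
  have h2t : (1 : ℝ) ≤ 2 ^ t := Real.one_le_rpow one_le_two ht
  obtain ⟨c, hc, hck⟩ : ∃ c : ℝ, 0 < c ∧ 2 ^ t * c = k :=
    ⟨k / 2 ^ t, by positivity, mul_div_cancel₀ k (by positivity)⟩
  obtain ⟨C, hC⟩ := hf.2 c hc
  have hC0 := nonneg_of_bound hc hC
  refine ⟨C + d * (C * c), fun α β x => ?_⟩
  have hcoord (j : Fin d) :
      |x j| * (|mpow x α| * ‖mderiv β f x‖) ≤ C * c * gsWeight t s k α β :=
    calc |x j| * (|mpow x α| * ‖mderiv β f x‖)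
        = |mpow x (α + Pi.single j 1)| * ‖mderiv β f x‖ := by
          rw [mpow_add_single, abs_mul]; ring
      _ ≤ C * gsWeight t s c (α + Pi.single j 1) β := hC _ β x
      _ ≤ C * (c * gsWeight t s (2 ^ t * c) α β) := by
          gcongr
          exact gsWeight_add_single_le ht hc.le α β j
      _ = _ := by rw [hck, mul_assoc]
  have hx : ‖x‖ ≤ ∑ j, |x j| := by
    rw [EuclideanSpace.norm_eq, Real.sqrt_le_left (Finset.sum_nonneg fun _ _ => abs_nonneg _)]
    exact Finset.sum_sq_le_sq_sum_of_nonneg fun _ _ => abs_nonneg _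
  have hw := gsWeight_mono t s hc (hck ▸ le_mul_of_one_le_left hc.le h2t) α β
  calc (1 + ‖x‖) * |mpow x α| * ‖mderiv β f x‖
      ≤ (1 + ∑ j, |x j|) * |mpow x α| * ‖mderiv β f x‖ := by gcongr
    _ = |mpow x α| * ‖mderiv β f x‖ + ∑ j, |x j| * (|mpow x α| * ‖mderiv β f x‖) := by
        rw [← Finset.sum_mul]; ring
    _ ≤ C * gsWeight t s k α β + ∑ _j : Fin d, C * c * gsWeight t s k α β :=
        add_le_add ((hC α β x).trans (by gcongr)) (Finset.sum_le_sum fun j _ => hcoord j)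
    _ = _ := by simp; ring

theorem abs_mpow_mul_norm_mderiv_mul_le (hs : 0 ≤ s) {k : ℝ} (hk : 0 < k) {f g : E d → ℂ}
    (hf : ContDiff ℝ ∞ f) (hg : ContDiff ℝ ∞ g) {v : E d → ℝ} (hv : ∀ x, 0 < v x) {A B : ℝ}
    (hA : ∀ (α β : Fin d → ℕ) (x : E d),
      v x * |mpow x α| * ‖mderiv β f x‖ ≤ A * gsWeight t s k α β)
    (hB : ∀ (x : E d) (n : ℕ), ‖iteratedFDeriv ℝ n g x‖ ≤ B * v x * (k ^ n * (n ! : ℝ) ^ s))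
    (α β : Fin d → ℕ) (x : E d) :
    |mpow x α| * ‖mderiv β (fun y => f y * g y) x‖ ≤
      A * B * gsWeight t s (((d : ℝ) + 1) ^ s * (2 * (((d : ℝ) + 1) * k))) α β := by
  have hD : 1 ≤ (d : ℝ) + 1 := by simp
  have hDs : 1 ≤ ((d : ℝ) + 1) ^ s := Real.one_le_rpow hD hs
  have hα := mfact_pos α
  have hβ := mfact_pos β
  have hvx := hv x
  have hA0 : 0 ≤ A := nonneg_of_mul_nonneg_left
    ((by positivity : 0 ≤ v x * |mpow x 0| * ‖mderiv 0 f x‖).trans (hA 0 0 x))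
    (gsWeight_pos t s hk 0 0)
  have hB0 : 0 ≤ B := by
    have := (norm_nonneg _).trans (hB x 0)
    simp only [pow_zero, Nat.factorial_zero, Nat.cast_one, Real.one_rpow, mul_one] at this
    exact nonneg_of_mul_nonneg_left this hvx
  have hfx : ∀ n : ℕ, v x * |mpow x α| * ‖iteratedFDeriv ℝ n f x‖ ≤
      A * (k ^ mlen α * (mfact α : ℝ) ^ t) * ((((d : ℝ) + 1) * k) ^ n * (n ! : ℝ) ^ s) :=
    norm_le_of_multi hs hf (by positivity) (by positivity) hk fun β => by
      have := hA α β x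
      rwa [gsWeight_split, ← mul_assoc] at this
  have hgx (n : ℕ) : ‖iteratedFDeriv ℝ n g x‖ ≤
      B * v x * ((((d : ℝ) + 1) * k) ^ n * (n ! : ℝ) ^ s) :=
    (hB x n).trans (by gcongr; exact le_mul_of_one_le_left hk.le hD)
  have hprod := multi_le_of_norm hs (hf.mul hg) (by positivity) (by positivity) (by positivity)
    (mul_norm_iteratedFDeriv_mul_le hs hf hg (by positivity) (by positivity) hfx hgx) β
  set h := ((d : ℝ) + 1) ^ s * (2 * (((d : ℝ) + 1) * k))
  have hkh : k ≤ h := by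
    have : k ≤ ((d : ℝ) + 1) * k := le_mul_of_one_le_left hk.le hD
    exact le_trans (by linarith) (le_mul_of_one_le_left (by positivity) hDs)
  refine le_of_mul_le_mul_left ?_ hvx
  calc v x * (|mpow x α| * ‖mderiv β (fun y => f y * g y) x‖)
      ≤ A * (k ^ mlen α * (mfact α : ℝ) ^ t) * (B * v x) *
        (h ^ mlen β * (mfact β : ℝ) ^ s) := by rwa [← mul_assoc]
    _ ≤ A * (h ^ mlen α * (mfact α : ℝ) ^ t) * (B * v x) *
        (h ^ mlen β * (mfact β : ℝ) ^ s) := by gcongr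
    _ = v x * (A * B * gsWeight t s h α β) := by rw [gsWeight_split]; ring

theorem norm_iteratedFDeriv_character_sub_one {ξ : E d} (hξ : ‖ξ‖ ≤ 1) (n : ℕ) (x : E d) :
    ‖iteratedFDeriv ℝ n
      (fun y : E d => Complex.exp (Complex.I * ((inner ℝ y ξ : ℝ) : ℂ)) - 1) x‖
      ≤ ‖ξ‖ * (1 + ‖x‖) := by
  cases n with
  | zero =>
    rw [norm_iteratedFDeriv_zero]
    refine Real.norm_exp_I_mul_ofReal_sub_one_le.trans ((norm_inner_le_norm x ξ).trans ?_)
    linarith [norm_nonneg ξ, mul_comm ‖x‖ ‖ξ‖]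
  | succ n =>
    have hsub := iteratedFDeriv_sub_apply (𝕜 := ℝ) (i := n + 1) (x := x)
      ((contDiff_character ξ).contDiffAt.of_le (by exact_mod_cast le_top))
      (contDiff_const (c := (1 : ℂ))).contDiffAt
    rw [iteratedFDeriv_const_of_ne n.succ_ne_zero, Pi.zero_apply, sub_zero] at hsub
    calc _ = ‖iteratedFDeriv ℝ (n + 1)
          (fun y : E d => Complex.exp (Complex.I * ((inner ℝ y ξ : ℝ) : ℂ))) x‖ := congrArg _ hsub
      _ ≤ ‖ξ‖ ^ (n + 1) := norm_iteratedFDeriv_character ξ _ x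
      _ ≤ ‖ξ‖ ^ 1 := pow_le_pow_of_le_one (norm_nonneg ξ) hξ (by omega)
      _ ≤ ‖ξ‖ * (1 + ‖x‖) := by
          rw [pow_one]
          exact le_mul_of_one_le_right (norm_nonneg ξ) (by linarith [norm_nonneg x])

end MultiIndex

namespace GelfandShilov

variable {d : ℕ} {t s : ℝ}

theorem exists_seminorm_le_of_toFun_eq_mul (hs : 0 ≤ s) (h : {h : ℝ // 0 < h}) :
    ∃ k : {h : ℝ // 0 < h}, ∀ {f q : GelfandShilov d t s} {g : E d → ℂ} {v : E d → ℝ} {A B : ℝ},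
      ContDiff ℝ ∞ g → q.toFun = (fun y => f.toFun y * g y) → (∀ x, 0 < v x) →
      (∀ (α β : Fin d → ℕ) (x : E d),
        v x * |mpow x α| * ‖mderiv β f.toFun x‖ ≤ A * gsWeight t s k.1 α β) →
      (∀ (x : E d) (n : ℕ),
        ‖iteratedFDeriv ℝ n g x‖ ≤ B * v x * (k.1 ^ n * (n ! : ℝ) ^ s)) →
      seminorm d t s h q ≤ A * B := by
  have hh := h.2
  refine ⟨⟨h.1 / (((d : ℝ) + 1) ^ s * (2 * ((d : ℝ) + 1))), by positivity⟩,
    fun {f q g v A B} hg hq hv hA hB => seminorm_le h q fun α β x => ?_⟩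
  have hbound := abs_mpow_mul_norm_mderiv_mul_le hs (by positivity) f.mem.1 hg hv hA hB α β x
  rw [hq]
  convert hbound using 3
  field_simp

theorem exists_seminorm_modulate_le (hs : 0 < s) (h : {h : ℝ // 0 < h}) :
    ∃ (k : {h : ℝ // 0 < h}) (r : ℝ), 0 ≤ r ∧ ∀ (ξ : E d) (f : GelfandShilov d t s),
      seminorm d t s h (f.modulate hs ξ) ≤
        seminorm d t s k f * Real.exp (r * ‖ξ‖ ^ (1 / s)) := by
  obtain ⟨k, hk⟩ := exists_seminorm_le_of_toFun_eq_mul (d := d) (t := t) hs.le h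
  have hk0 := k.2
  refine ⟨k, s * (k.1 ^ (1 / s))⁻¹, by positivity, fun ξ f => ?_⟩
  refine hk (v := fun _ => 1) (contDiff_character ξ) (funext fun y => mul_comm _ _)
    (fun _ => one_pos) (fun α β x => ?_) fun x n => ?_
  · rw [one_mul]
    exact le_seminorm k f α β x
  · have hpow := pow_le_exp_mul_factorial hs (norm_nonneg ξ) hk0 n
    rw [Real.div_rpow (norm_nonneg _) hk0.le, div_eq_inv_mul, ← mul_assoc s] at hpow
    rw [mul_one]
    exact (norm_iteratedFDeriv_character ξ n x).trans hpow

theorem modulate_modulate (hs : 0 < s) (ξ η : E d) (f : GelfandShilov d t s) :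
    (f.modulate hs ξ).modulate hs η = f.modulate hs (ξ + η) := by
  refine GelfandShilov.ext (funext fun y => ?_)
  change Complex.exp _ * (Complex.exp _ * _) = Complex.exp _ * _
  rw [← mul_assoc, ← Complex.exp_add, inner_add_right, ← mul_add, ← Complex.ofReal_add, add_comm]

theorem modulate_sub (hs : 0 < s) (ξ : E d) (f g : GelfandShilov d t s) :
    (f - g).modulate hs ξ = f.modulate hs ξ - g.modulate hs ξ :=
  GelfandShilov.ext (funext fun y => mul_sub _ (f.toFun y) (g.toFun y))

theorem exists_seminorm_modulate_sub_le (ht : 0 ≤ t) (hs : 0 < s) (h : {h : ℝ // 0 < h})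
    (f : GelfandShilov d t s) : ∃ C : ℝ, ∀ ξ : E d, ‖ξ‖ ≤ 1 →
      seminorm d t s h (f.modulate hs ξ - f) ≤ C * ‖ξ‖ := by
  obtain ⟨k, hk⟩ := exists_seminorm_le_of_toFun_eq_mul (d := d) (t := t) hs.le h
  obtain ⟨B, hB⟩ := exists_one_add_norm_mul_le ht f.mem k.2
  obtain ⟨A, -, hA⟩ := exists_pow_le hs 1 zero_le_one k.2
  refine ⟨B * A, fun ξ hξ => ?_⟩
  rw [mul_assoc]
  refine hk ((contDiff_character ξ).sub (contDiff_const (c := 1)))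
    (funext fun y => ?_) (fun x => by positivity) hB fun x n => ?_
  · change Complex.exp _ * f.toFun y - f.toFun y = _
    ring
  · calc _ ≤ ‖ξ‖ * (1 + ‖x‖) * 1 ^ n := by
          rw [one_pow, mul_one]
          exact norm_iteratedFDeriv_character_sub_one hξ n x
      _ ≤ ‖ξ‖ * (1 + ‖x‖) * (A * (k.1 ^ n * (n ! : ℝ) ^ s)) := by gcongr; exact hA n
      _ = _ := by ring

theorem continuous_modulate (ht : 0 ≤ t) (hs : 0 < s) (f : GelfandShilov d t s) :
    Continuous fun ξ : E d => f.modulate hs ξ := by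
  rw [continuous_iff_continuousAt]
  intro ξ₀
  rw [ContinuousAt, (withSeminorms d t s).tendsto_nhds]
  intro h ε hε
  obtain ⟨k, r, -, hk⟩ := exists_seminorm_modulate_le (d := d) (t := t) hs h
  obtain ⟨C, hC⟩ := exists_seminorm_modulate_sub_le ht hs k f
  have hlim : Filter.Tendsto (fun ξ : E d => C * ‖ξ - ξ₀‖ * Real.exp (r * ‖ξ₀‖ ^ (1 / s)))
      (nhds ξ₀) (nhds 0) := by
    refine Continuous.tendsto' (by fun_prop) _ _ ?_
    simp
  filter_upwards [hlim.eventually_lt_const hε, Metric.closedBall_mem_nhds ξ₀ one_pos] with ξ hξ h1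
  calc seminorm d t s h (f.modulate hs ξ - f.modulate hs ξ₀)
      = seminorm d t s h ((f.modulate hs (ξ - ξ₀) - f).modulate hs ξ₀) := by
        rw [modulate_sub, modulate_modulate, sub_add_cancel]
    _ ≤ seminorm d t s k (f.modulate hs (ξ - ξ₀) - f) * Real.exp (r * ‖ξ₀‖ ^ (1 / s)) := hk _ _
    _ ≤ C * ‖ξ - ξ₀‖ * Real.exp (r * ‖ξ₀‖ ^ (1 / s)) := by
        gcongr
        exact hC _ (mem_closedBall_iff_norm.mp h1)
    _ < ε := hξ

end GelfandShilov

/-! ### Integrals of families of test functions -/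

section Integral

open MeasureTheory

variable {d : ℕ}

theorem foldr_pderiv_eq_mderiv (l : List (Fin d)) {f : E d → ℂ} (hf : ContDiff ℝ ∞ f) :
    l.foldr pderiv f = mderiv (fun j => l.count j) f := by
  rw [mderiv_eq_foldr]
  refine foldr_perm (List.perm_iff_count.2 fun j => ?_) hf
  rw [count_dirs]

theorem hasDerivAt_add_smul_single {f : E d → ℂ} (hf : ContDiff ℝ ∞ f) (j : Fin d) (y : E d)
    (r : ℝ) : HasDerivAt (fun r : ℝ => f (y + r • EuclideanSpace.single j (1 : ℝ)))
      (pderiv j f (y + r • EuclideanSpace.single j (1 : ℝ))) r := by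
  have hline : HasDerivAt (fun r : ℝ => y + r • (EuclideanSpace.single j (1 : ℝ) : E d))
      (EuclideanSpace.single j (1 : ℝ)) r := by
    simpa using ((hasDerivAt_id r).smul_const (EuclideanSpace.single j (1 : ℝ) : E d)).const_add y
  exact (hf.differentiable (by simp) _).hasFDerivAt.comp_hasDerivAt r hline

theorem foldr_pderiv_integral {Ω : Type*} [MeasurableSpace Ω] {μ : Measure Ω}
    {F : Ω → E d → ℂ} {q : E d → ℂ} (hF : ∀ w, ContDiff ℝ ∞ (F w)) (hq : ContDiff ℝ ∞ q)
    (hFq : ∀ y, q y = ∫ w, F w y ∂μ)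
    (hmeas : ∀ (l : List (Fin d)) (y : E d),
      AEStronglyMeasurable (fun w => l.foldr pderiv (F w) y) μ)
    (hbound : ∀ l : List (Fin d), ∃ b : Ω → ℝ, Integrable b μ ∧
      ∀ w y, ‖l.foldr pderiv (F w) y‖ ≤ b w) (l : List (Fin d)) (y : E d) :
    l.foldr pderiv q y = ∫ w, l.foldr pderiv (F w) y ∂μ := by
  induction l generalizing y with
  | nil => exact hFq y
  | cons j l ih =>
    obtain ⟨b₀, hb₀, hFb₀⟩ := hbound l
    obtain ⟨b, hb, hFb⟩ := hbound (j :: l)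
    have hderiv := (hasDerivAt_integral_of_dominated_loc_of_deriv_le (μ := μ) (x₀ := (0 : ℝ))
      (F := fun r w => l.foldr pderiv (F w) (y + r • EuclideanSpace.single j (1 : ℝ)))
      (F' := fun r w => (j :: l).foldr pderiv (F w) (y + r • EuclideanSpace.single j (1 : ℝ)))
      (bound := b) Filter.univ_mem (Filter.Eventually.of_forall fun r => hmeas l _)
      (hb₀.mono' (hmeas l _) (Filter.Eventually.of_forall fun w => hFb₀ w _))
      (hmeas (j :: l) _) (Filter.Eventually.of_forall fun w r _ => hFb w _) hb
      (Filter.Eventually.of_forall fun w r _ =>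
        hasDerivAt_add_smul_single (contDiff_foldr l (hF w)) j y r)).2
    simp only [← ih] at hderiv
    simpa using (hasDerivAt_add_smul_single (contDiff_foldr l hq) j y 0).unique hderiv

end Integral

namespace GelfandShilov

open MeasureTheory

variable {d : ℕ} {t s : ℝ}

/-- The indices of the quotients whose supremum is the norm of `Σ_t^s(ℝ^d)`: the multi-index `α` of
the weight `x^α`, the multi-index `β` of the derivative, and the point `x`. -/
abbrev RatioIndex (d : ℕ) : Type := (Fin d → ℕ) × (Fin d → ℕ) × E d

/-- The isometric embedding of `Σ_t^s(ℝ^d)` with the norm `‖·‖_h` into a space of bounded functions,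
by the quotients defining that norm. It replaces the completion of `Σ_t^s(ℝ^d)`: vector-valued
integrals are taken in its complete target. -/
noncomputable def toLp (h : {h : ℝ // 0 < h}) :
    GelfandShilov d t s →ₗ[ℂ] lp (fun _ : RatioIndex d => ℂ) ⊤ where
  toFun f := ⟨fun p => ((mpow p.2.2 p.1 / gsWeight t s h.1 p.1 p.2.1 : ℝ) : ℂ) *
      mderiv p.2.1 f.toFun p.2.2, memℓp_infty (by
    refine ⟨seminorm d t s h f, ?_⟩
    rintro _ ⟨p, rfl⟩
    have hw := gsWeight_pos t s h.2 p.1 p.2.1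
    change ‖_ * _‖ ≤ _
    rw [norm_mul, Complex.norm_real, Real.norm_eq_abs, abs_div, abs_of_pos hw, div_mul_eq_mul_div,
      div_le_iff₀ hw]
    exact le_seminorm h f _ _ _)⟩
  map_add' f g := by
    ext p
    change _ * mderiv p.2.1 (f + g).toFun p.2.2 = _ * mderiv p.2.1 f.toFun p.2.2 +
      _ * mderiv p.2.1 g.toFun p.2.2
    rw [toFun_add, mderiv_add _ f.mem.1 g.mem.1, Pi.add_apply, mul_add]
  map_smul' c f := by
    ext p
    change _ * mderiv p.2.1 (c • f).toFun p.2.2 = c * (_ * mderiv p.2.1 f.toFun p.2.2)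
    rw [toFun_smul, mderiv_smul _ _ f.mem.1, Pi.smul_apply, smul_eq_mul]
    ring

theorem toLp_apply (h : {h : ℝ // 0 < h}) (f : GelfandShilov d t s) (p : RatioIndex d) :
    toLp h f p = ((mpow p.2.2 p.1 / gsWeight t s h.1 p.1 p.2.1 : ℝ) : ℂ) *
      mderiv p.2.1 f.toFun p.2.2 := rfl

theorem mderiv_eq_gsWeight_mul_toLp (h : {h : ℝ // 0 < h}) (f : GelfandShilov d t s)
    (β : Fin d → ℕ) (y : E d) :
    mderiv β f.toFun y = ((gsWeight t s h.1 0 β : ℝ) : ℂ) * toLp h f (0, β, y) := by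
  have hw : ((gsWeight t s h.1 0 β : ℝ) : ℂ) ≠ 0 := by
    exact_mod_cast (gsWeight_pos t s h.2 (0 : Fin d → ℕ) β).ne'
  have hmpow : mpow y (0 : Fin d → ℕ) = 1 := by simp [mpow]
  rw [toLp_apply, hmpow]
  push_cast
  field_simp

theorem norm_toLp_apply (h : {h : ℝ // 0 < h}) (f : GelfandShilov d t s) (p : RatioIndex d) :
    ‖toLp h f p‖ = ratio h.1 f p := by
  have hw := gsWeight_pos t s h.2 p.1 p.2.1
  rw [toLp_apply, norm_mul, Complex.norm_real, Real.norm_eq_abs, abs_div, abs_of_pos hw,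
    div_mul_eq_mul_div, ratio]

theorem norm_toLp (h : {h : ℝ // 0 < h}) (f : GelfandShilov d t s) :
    ‖toLp h f‖ = seminorm d t s h f := by
  refine le_antisymm (lp.norm_le_of_forall_le (apply_nonneg _ _) fun p => ?_)
    (ciSup_le fun p => ?_)
  · rw [norm_toLp_apply]
    exact le_ciSup (bddAbove_ratio h.2 f) p
  · rw [← norm_toLp_apply]
    exact lp.norm_apply_le_norm (by simp) _ p

theorem continuous_toLp (h : {h : ℝ // 0 < h}) :
    Continuous (toLp h : GelfandShilov d t s →ₗ[ℂ] lp (fun _ : RatioIndex d => ℂ) ⊤) := by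
  refine (withSeminorms d t s).continuous_normedSpace_rng _ _ ⟨{h}, 1, fun f => ?_⟩
  rw [one_smul, Finset.sup_singleton]
  exact (norm_toLp h f).le

theorem toLp_injective (h : {h : ℝ // 0 < h}) :
    Function.Injective (toLp h : GelfandShilov d t s →ₗ[ℂ] lp (fun _ : RatioIndex d => ℂ) ⊤) := by
  intro f g hfg
  refine GelfandShilov.ext (funext fun x => ?_)
  have hmderiv : mderiv (0 : Fin d → ℕ) = id := by
    funext f
    simp [mderiv]
  have hfx := mderiv_eq_gsWeight_mul_toLp h f 0 x
  rwa [hfg, ← mderiv_eq_gsWeight_mul_toLp, hmderiv] at hfx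

section Integral

variable {Ω : Type*} [TopologicalSpace Ω] [MeasurableSpace Ω] [OpensMeasurableSpace Ω]
  {μ : Measure Ω} {Φ : Ω → GelfandShilov d t s}
  {h : {h : ℝ // 0 < h}} {q : GelfandShilov d t s}

theorem mderiv_eq_integral (hΦ : Continuous Φ)
    (hint : Integrable (fun w => seminorm d t s h (Φ w)) μ)
    (hq : ∀ y, q.toFun y = ∫ w, (Φ w).toFun y ∂μ) (β : Fin d → ℕ) (y : E d) :
    mderiv β q.toFun y = ∫ w, mderiv β (Φ w).toFun y ∂μ := by
  simp only [mderiv_eq_foldr]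
  refine foldr_pderiv_integral (fun w => (Φ w).mem.1) q.mem.1 hq (fun l y => ?_) (fun l => ?_) _ y
  · simp only [foldr_pderiv_eq_mderiv l (Φ _).mem.1, mderiv_eq_gsWeight_mul_toLp h]
    exact (continuous_const.mul ((lp.evalCLM ℂ (fun _ : RatioIndex d => ℂ) ⊤ _).continuous.comp
      ((continuous_toLp h).comp hΦ))).aestronglyMeasurable
  · refine ⟨fun w => seminorm d t s h (Φ w) * gsWeight t s h.1 0 (fun j => l.count j),
      hint.mul_const _, fun w y => ?_⟩
    rw [foldr_pderiv_eq_mderiv l (Φ w).mem.1]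
    simpa [mpow] using le_seminorm h (Φ w) 0 (fun j => l.count j) y

variable [SecondCountableTopology Ω]

theorem integrable_toLp_comp (hΦ : Continuous Φ)
    (hint : Integrable (fun w => seminorm d t s h (Φ w)) μ) :
    Integrable (fun w => toLp h (Φ w)) μ :=
  hint.mono' ((continuous_toLp h).comp hΦ).aestronglyMeasurable
    (Filter.Eventually.of_forall fun _ => (norm_toLp h _).le)

theorem toLp_eq_integral (hΦ : Continuous Φ)
    (hint : Integrable (fun w => seminorm d t s h (Φ w)) μ)
    (hq : ∀ y, q.toFun y = ∫ w, (Φ w).toFun y ∂μ) :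
    toLp h q = ∫ w, toLp h (Φ w) ∂μ := by
  ext p
  have heval : ∫ w, toLp h (Φ w) p ∂μ =
      (∫ w, toLp h (Φ w) ∂μ : lp (fun _ : RatioIndex d => ℂ) ⊤) p :=
    (lp.evalCLM ℂ (fun _ : RatioIndex d => ℂ) ⊤ p).integral_comp_comm
      (integrable_toLp_comp hΦ hint)
  rw [← heval]
  simp only [toLp_apply]
  rw [integral_const_mul, mderiv_eq_integral hΦ hint hq]

end Integral

end GelfandShilov

namespace GelfandShilovDual

open MeasureTheory GelfandShilov

variable {d : ℕ} {t s : ℝ}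

theorem exists_norm_apply_le (u : GelfandShilovDual d t s) :
    ∃ (h : {h : ℝ // 0 < h}) (C : ℝ), 0 ≤ C ∧ ∀ f, ‖u f‖ ≤ C * seminorm d t s h f := by
  obtain ⟨S, C, -, hC⟩ := Seminorm.bound_of_continuous (withSeminorms d t s)
    ((normSeminorm ℂ ℂ).comp u.toLinearMap) (continuous_norm.comp u.continuous)
  obtain ⟨k, hk⟩ := S.bddBelow
  have hsup : S.sup (seminorm d t s) ≤ seminorm d t s k :=
    Finset.sup_le fun h hh => seminorm_anti (hk hh)
  exact ⟨k, C, C.2, fun f => (hC f).trans (mul_le_mul_of_nonneg_left (hsup f) C.2)⟩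

/-- By Hahn–Banach, since `u` is bounded for one of the norms `‖·‖_h`. -/
theorem exists_apply_toLp_eq (u : GelfandShilovDual d t s) :
    ∃ (h : {h : ℝ // 0 < h}) (v : lp (fun _ : RatioIndex d => ℂ) ⊤ →L[ℂ] ℂ),
      ∀ f, v (toLp h f) = u f := by
  obtain ⟨h, C, -, hC⟩ := u.exists_norm_apply_le
  let e := LinearEquiv.ofInjective (toLp h : GelfandShilov d t s →ₗ[ℂ] _) (toLp_injective h)
  let w : StrongDual ℂ (LinearMap.range (toLp h : GelfandShilov d t s →ₗ[ℂ] _)) :=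
    (u.toLinearMap ∘ₗ e.symm.toLinearMap).mkContinuous C fun y => by
      obtain ⟨f, rfl⟩ := e.surjective y
      change ‖u (e.symm (e f))‖ ≤ C * ‖toLp h f‖
      rw [e.symm_apply_apply, norm_toLp]
      exact hC f
  obtain ⟨v, hv, -⟩ := exists_extension_norm_eq _ w
  refine ⟨h, v, fun f => ?_⟩
  calc v (toLp h f) = u (e.symm (e f)) := hv (e f)
    _ = u f := by rw [e.symm_apply_apply]

theorem apply_eq_integral {Ω : Type*} [TopologicalSpace Ω] [SecondCountableTopology Ω]
    [MeasurableSpace Ω] [OpensMeasurableSpace Ω] {μ : Measure Ω} (u : GelfandShilovDual d t s)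
    {Φ : Ω → GelfandShilov d t s} (hΦ : Continuous Φ)
    (hint : ∀ h, Integrable (fun w => seminorm d t s h (Φ w)) μ) {q : GelfandShilov d t s}
    (hq : ∀ y, q.toFun y = ∫ w, (Φ w).toFun y ∂μ) : u q = ∫ w, u (Φ w) ∂μ := by
  obtain ⟨h, v, hv⟩ := u.exists_apply_toLp_eq
  simp only [← hv]
  rw [toLp_eq_integral hΦ (hint h) hq, v.integral_comp_comm (integrable_toLp_comp hΦ (hint h))]

end GelfandShilovDual

/-! ### Localization of the short-time Fourier transform -/

section Localization

open FourierTransform MeasureTheory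

variable {d : ℕ} {t s : ℝ}

theorem IsUniformGevrey.integrable_fourier (hs : 1 ≤ s) {g : E d → ℂ} (hg : IsUniformGevrey s g)
    (hgc : HasCompactSupport g) : Integrable (𝓕 g) := by
  have hFc := continuous_fourier (hg.1.continuous.integrable_of_hasCompactSupport hgc)
  refine (integrable_norm_iff hFc.aestronglyMeasurable).mp ?_
  simpa using (hg.hasGevreyDecayOn_fourier (by linarith) hgc).integrable_exp_mul hs
    hFc.aestronglyMeasurable 0

theorem GelfandShilov.integrable_seminorm_smul_modulate (ht : 0 ≤ t) (hs : 0 < s) (hs1 : 1 ≤ s)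
    {K : E d → ℂ} (hK : HasGevreyDecayOn s K Set.univ) (hKc : Continuous K) {μ : Measure (E d)}
    [μ.IsAddHaarMeasure] (c : ℝ) (p : GelfandShilov d t s) (h : {h : ℝ // 0 < h}) :
    Integrable (fun w => seminorm d t s h (K w • p.modulate hs (c • w))) μ := by
  obtain ⟨k, r, -, hk⟩ := exists_seminorm_modulate_le (d := d) (t := t) hs h
  have := (withSeminorms d t s).continuousSMul
  have hcont : Continuous fun w => K w • p.modulate hs (c • w) :=
    hKc.smul ((continuous_modulate ht hs p).comp (continuous_const_smul c))
  refine Integrable.mono' ((hK.integrable_exp_mul (μ := μ) hs1 hKc.aestronglyMeasurable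
    (r * |c| ^ (1 / s))).const_mul (seminorm d t s k p))
    (((withSeminorms d t s).continuous_seminorm h).comp hcont).aestronglyMeasurable
    (Filter.Eventually.of_forall fun w => ?_)
  rw [Real.norm_of_nonneg (apply_nonneg _ _), map_smul_eq_mul]
  calc ‖K w‖ * seminorm d t s h (p.modulate hs (c • w))
      ≤ ‖K w‖ * (seminorm d t s k p * Real.exp (r * ‖c • w‖ ^ (1 / s))) := by
        gcongr
        exact hk _ p
    _ = _ := by
        rw [norm_smul, Real.norm_eq_abs, Real.mul_rpow (abs_nonneg c) (norm_nonneg w)]; ring_nf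

theorem GelfandShilov.toFun_mul_eq_integral_fourier (hs : 0 < s) (p : GelfandShilov d t s)
    {g : E d → ℂ} (hgc : Continuous g) (hgi : Integrable g) (hFi : Integrable (𝓕 g)) (y : E d) :
    p.toFun y * g y = ∫ w, (𝓕 g w • p.modulate hs ((2 * Real.pi) • w)).toFun y := by
  have hinv := congrFun (hgc.fourierInv_fourier_eq hgi hFi) y
  rw [Real.fourierInv_eq'] at hinv
  rw [← hinv, ← integral_const_mul]
  refine integral_congr_ae (Filter.Eventually.of_forall fun w => ?_)
  change p.toFun y * (Complex.exp (((2 * Real.pi * inner ℝ w y : ℝ) : ℂ) * Complex.I) * 𝓕 g w) =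
    𝓕 g w * (Complex.exp (Complex.I * ((inner ℝ y ((2 * Real.pi) • w) : ℝ) : ℂ)) * p.toFun y)
  rw [inner_smul_right, real_inner_comm, mul_comm Complex.I]
  ring

theorem GelfandShilovDual.apply_eq_integral_fourier (ht : 0 ≤ t) (hs : 0 < s) (hs1 : 1 ≤ s)
    (u : GelfandShilovDual d t s) {p q : GelfandShilov d t s} {g : E d → ℂ}
    (hg : IsUniformGevrey s g) (hgc : HasCompactSupport g)
    (hq : q.toFun = fun y => p.toFun y * g y) :
    u q = ∫ w, 𝓕 g w * u (p.modulate hs ((2 * Real.pi) • w)) := by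
  have hgi : Integrable g := hg.1.continuous.integrable_of_hasCompactSupport hgc
  have hFc : Continuous (𝓕 g) := continuous_fourier hgi
  have := (GelfandShilov.withSeminorms d t s).continuousSMul
  have hΦ : Continuous fun w => 𝓕 g w • p.modulate hs ((2 * Real.pi) • w) :=
    hFc.smul ((GelfandShilov.continuous_modulate ht hs p).comp (continuous_const_smul _))
  have happly := u.apply_eq_integral (μ := volume) hΦ
    (GelfandShilov.integrable_seminorm_smul_modulate ht hs hs1
      (hg.hasGevreyDecayOn_fourier hs hgc) hFc _ p)
    fun y => (congrFun hq y).trans (p.toFun_mul_eq_integral_fourier hs hg.1.continuous hgi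
      (hg.integrable_fourier hs1 hgc) y)
  simpa only [map_smul, smul_eq_mul] using happly

theorem stft_eq (ht : 0 < t) (hs : 0 < s) (ψ : GelfandShilov d t s) (u : GelfandShilovDual d t s)
    (x ξ : E d) : stft ht hs ψ u x ξ = (((2 * Real.pi) ^ (-(d : ℝ) / 2) : ℝ) : ℂ) *
      u ((ψ.translate ht x).conj.modulate hs (-ξ)) := by
  unfold stft
  congr 2
  refine GelfandShilov.ext (funext fun y => ?_)
  change starRingEnd ℂ (Complex.exp _ * _) = Complex.exp _ * starRingEnd ℂ _
  rw [map_mul, ← Complex.exp_conj, map_mul, Complex.conj_I, Complex.conj_ofReal, inner_neg_right,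
    Complex.ofReal_neg, neg_mul_comm]

theorem localFourier_eq_integral_stft (ht : 0 < t) (hs : 0 < s) (hs1 : 1 ≤ s)
    (ψ : GelfandShilov d t s) (u : GelfandShilovDual d t s) (x : E d) {g : E d → ℂ}
    (hg : IsUniformGevrey s g) (hgc : HasCompactSupport g) {χ : gevreyC d s}
    (hχ : χ.1 = fun y => (ψ.translate ht x).conj.toFun y * g y) (ξ : E d) :
    localFourier hs (u.toGevrey ht) χ ξ =
      ∫ w, 𝓕 g w * stft ht hs ψ u x (ξ - (2 * Real.pi) • w) := by
  set p := (ψ.translate ht x).conj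
  have happly := u.apply_eq_integral_fourier ht.le hs hs1 (p := p.modulate hs (-ξ))
    (q := gevreyInclusion d s ht (gevreyModulate hs (-ξ) χ)) hg hgc (funext fun y => by
      change Complex.exp _ * χ.1 y = Complex.exp _ * p.toFun y * g y
      rw [hχ, mul_assoc])
  change _ * u (gevreyInclusion d s ht (gevreyModulate hs (-ξ) χ)) = _
  rw [happly, ← integral_const_mul]
  refine integral_congr_ae (Filter.Eventually.of_forall fun w => ?_)
  simp only [GelfandShilov.modulate_modulate, stft_eq, neg_sub', neg_add_eq_sub, sub_neg_eq_add]
  ring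

end Localization

/-! ### Comparison of the wave front sets -/

theorem exists_scaling_near {X F : Type*} [NormedAddCommGroup X] [NormedSpace ℝ X]
    [NormedAddCommGroup F] [NormedSpace ℝ F] {t s ε : ℝ} (ht : 0 < t) (hs : 0 < s) {ξ₀ : F}
    (hε : 0 < ε) (hεξ : ε ≤ ‖ξ₀‖) (x : X) :
    ∃ R : ℝ, ∀ ξ ∈ coneAbout ξ₀ ε, R < ‖ξ‖ → ∃ m : ℝ, 0 < m ∧ ‖(m ^ t)⁻¹ • x‖ < ε ∧
      ‖(m ^ s)⁻¹ • ξ - ξ₀‖ < ε ∧ ‖ξ‖ ^ (1 / s) ≤ (2 * ‖ξ₀‖) ^ (1 / s) * m := by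
  have hξ₀ : 0 < ‖ξ₀‖ := hε.trans_le hεξ
  set a : ℝ := (2 * ‖ξ₀‖) ^ (1 / s)
  have ha : 0 < a := by positivity
  refine ⟨(a * (‖x‖ / ε) ^ (1 / t)) ^ s, ?_⟩
  rintro ξ ⟨l, hl, hlξ⟩ hR
  have hm : 0 < l⁻¹ ^ (1 / s) := by positivity
  have hms : (l⁻¹ ^ (1 / s)) ^ s = l⁻¹ := by
    rw [← Real.rpow_mul (by positivity), one_div_mul_cancel hs.ne', Real.rpow_one]
  have hξm : ‖ξ‖ ^ (1 / s) ≤ a * l⁻¹ ^ (1 / s) := by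
    rw [← Real.mul_rpow (by positivity) (by positivity)]
    refine Real.rpow_le_rpow (norm_nonneg _) ?_ (by positivity)
    rw [← div_eq_mul_inv, le_div_iff₀' hl]
    exact mul_norm_le_of_norm_sub_lt hl hεξ hlξ
  refine ⟨l⁻¹ ^ (1 / s), hm, ?_, by rwa [hms, inv_inv], hξm⟩
  have hlt : (‖x‖ / ε) ^ (1 / t) < l⁻¹ ^ (1 / s) := by
    refine lt_of_mul_lt_mul_left (lt_of_lt_of_le ?_ hξm) ha.le
    rwa [one_div s, Real.lt_rpow_inv_iff_of_pos (by positivity) (norm_nonneg ξ) hs]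
  rw [one_div t, Real.rpow_inv_lt_iff_of_pos (by positivity) hm.le ht, div_lt_iff₀' hε] at hlt
  rw [norm_smul, Real.norm_of_nonneg (by positivity), inv_mul_lt_iff₀' (by positivity)]
  exact hlt

section WaveFrontSet

variable {d : ℕ} {t s : ℝ}

theorem hasGevreyGrowth_stft (ht : 0 < t) (hs : 0 < s) (ψ : GelfandShilov d t s)
    (u : GelfandShilovDual d t s) (x : E d) : HasGevreyGrowth s (stft ht hs ψ u x) := by
  obtain ⟨h, C, hC0, hC⟩ := u.exists_norm_apply_le
  obtain ⟨k, r, hr, hk⟩ := GelfandShilov.exists_seminorm_modulate_le (d := d) (t := t) hs h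
  set p := (ψ.translate ht x).conj
  set c : ℂ := (((2 * Real.pi) ^ (-(d : ℝ) / 2) : ℝ) : ℂ)
  refine ⟨‖c‖ * (C * GelfandShilov.seminorm d t s k p), r, hr, fun ξ => ?_⟩
  have hmod := hk (-ξ) p
  rw [norm_neg] at hmod
  calc ‖stft ht hs ψ u x ξ‖ = ‖c‖ * ‖u (p.modulate hs (-ξ))‖ := by rw [stft_eq, norm_mul]
    _ ≤ ‖c‖ * (C * (GelfandShilov.seminorm d t s k p * Real.exp (r * ‖ξ‖ ^ (1 / s)))) := by
        gcongr
        exact (hC _).trans (by gcongr)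
    _ = _ := by ring

/-- Far out in a cone about `ξ₀` the anisotropic scaling moves the first variable `x` close to `0`,
hence the point `(x, ξ)` into any prescribed neighbourhood of `(0, ξ₀)`. -/
theorem exists_hasGevreyDecayOn_stft (ht : 0 < t) (hs : 0 < s) {ψ : GelfandShilov d t s}
    {u : GelfandShilovDual d t s} {ξ₀ : E d} (hξ₀ : ξ₀ ≠ 0)
    (h : ((0 : E d), ξ₀) ∉ gsWaveFrontSet ht hs ψ u) (x : E d) :
    ∃ ε, 0 < ε ∧ ε ≤ ‖ξ₀‖ ∧ HasGevreyDecayOn s (stft ht hs ψ u x) (coneAbout ξ₀ ε) := by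
  simp only [gsWaveFrontSet, Set.mem_ofPred_eq, not_and, not_not] at h
  obtain ⟨U, hU, -, hmem, hdecay⟩ := h fun h => hξ₀ (congrArg Prod.snd h)
  obtain ⟨δ, hδ, hball⟩ := Metric.isOpen_iff.mp hU _ hmem
  have hε : 0 < min δ ‖ξ₀‖ := lt_min hδ (norm_pos_iff.mpr hξ₀)
  refine ⟨min δ ‖ξ₀‖, hε, min_le_right _ _, ?_⟩
  obtain ⟨R, hR⟩ := exists_scaling_near ht hs hε (min_le_right _ _) x
  refine (hasGevreyGrowth_stft ht hs ψ u x).hasGevreyDecayOn hs (R := R) fun r hr => ?_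
  obtain ⟨C, hC⟩ := hdecay (r * (2 * ‖ξ₀‖) ^ (1 / s)) (by positivity)
  refine ⟨C, fun ξ ⟨hξ, hRξ⟩ => ?_⟩
  obtain ⟨m, hm, hx, hξm, hle⟩ := hR ξ hξ hRξ
  have hU : ((m ^ t)⁻¹ • x, (m ^ s)⁻¹ • ξ) ∈ U := by
    refine hball ?_
    rw [Metric.mem_ball, Prod.dist_eq, max_lt_iff, dist_zero_right, dist_eq_norm]
    exact ⟨hx.trans_le (min_le_left _ _), hξm.trans_le (min_le_left _ _)⟩
  have hscaled := hC m hm _ hU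
  simp only [smul_inv_smul₀ (Real.rpow_pos_of_pos hm _).ne'] at hscaled
  refine le_trans ?_ hscaled
  rw [mul_assoc r]
  gcongr

theorem exists_conj_translate_ne_zero (ht : 0 < t) {ψ : GelfandShilov d t s} (hψ : ψ ≠ 0)
    (x₀ : E d) : ∃ x, (ψ.translate ht x).conj.toFun x₀ ≠ 0 := by
  obtain ⟨y₀, hy₀⟩ : ∃ y₀, ψ.toFun y₀ ≠ 0 := by
    by_contra! h
    exact hψ (GelfandShilov.ext (funext h))
  refine ⟨x₀ - y₀, ?_⟩
  change starRingEnd ℂ (ψ.toFun (x₀ - (x₀ - y₀))) ≠ 0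
  rwa [sub_sub_cancel, map_ne_zero]

theorem exists_gevreyC_eq_mul (hs : 1 < s) {p : GelfandShilov d t s} {x₀ : E d}
    (hp : p.toFun x₀ ≠ 0) : ∃ (g : E d → ℂ) (χ : gevreyC d s), IsUniformGevrey s g ∧
      HasCompactSupport g ∧ (χ.1 = fun y => p.toFun y * g y) ∧ χ.1 x₀ = 1 := by
  have hs0 : 0 ≤ s := by linarith
  obtain ⟨g₀, hg₀, hg₀c, hg₀x⟩ := exists_isUniformGevrey_hasCompactSupport_ne_zero hs x₀
  have hg := (IsUniformGevrey.const (p.toFun x₀ * g₀ x₀)⁻¹).mul hs0 hg₀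
  refine ⟨fun y => (p.toFun x₀ * g₀ x₀)⁻¹ * g₀ y, ⟨_, ((p.mem.isUniformGevrey hs0).mul hs0
    hg).isGevrey hs0, hg₀c.mul_left.mul_left⟩, hg, hg₀c.mul_left, rfl, ?_⟩
  change p.toFun x₀ * ((p.toFun x₀ * g₀ x₀)⁻¹ * g₀ x₀) = 1
  field_simp

theorem notMem_gevreyWaveFrontSet (ht : 0 < t) (hs : 0 < s) (hs1 : 1 < s)
    {ψ : GelfandShilov d t s} (hψ : ψ ≠ 0) {u : GelfandShilovDual d t s} {ξ₀ : E d}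
    (hξ₀ : ξ₀ ≠ 0) (h : ((0 : E d), ξ₀) ∉ gsWaveFrontSet ht hs ψ u) (x₀ : E d) :
    (x₀, ξ₀) ∉ gevreyWaveFrontSet hs (u.toGevrey ht) := by
  obtain ⟨x, hx⟩ := exists_conj_translate_ne_zero ht hψ x₀
  obtain ⟨g, χ, hg, hgc, hχ, hχx⟩ := exists_gevreyC_eq_mul hs1 hx
  obtain ⟨ε, hε, hεξ, hdecay⟩ := exists_hasGevreyDecayOn_stft ht hs hξ₀ h x
  have hlocal : HasGevreyDecayOn s (localFourier hs (u.toGevrey ht) χ)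
      (coneAbout ξ₀ (ε / 2)) := by
    rw [funext (localFourier_eq_integral_stft ht hs hs1.le ψ u x hg hgc hχ)]
    exact HasGevreyDecayOn.integral_mul_sub_smul hs1.le (hg.hasGevreyDecayOn_fourier hs hgc)
      (hg.integrable_fourier hs1.le hgc).aestronglyMeasurable
      (hasGevreyGrowth_stft ht hs ψ u x) hdecay (by positivity)
      (fun ξ hξ η hη => sub_mem_coneAbout hε hεξ hξ hη) _
  exact fun hmem => hmem.2 ⟨χ, hχx, coneAbout ξ₀ (ε / 2), isOpen_coneAbout _ _,
    fun l hl ξ hξ => smul_mem_coneAbout hl hξ, zero_notMem_coneAbout (by linarith),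
    self_mem_coneAbout _ (by positivity), hlocal⟩

end WaveFrontSet

end GelfandShilovWF

theorem proposition5p1_general (d : ℕ) (t s : ℝ) (ht : 0 < t) (hs : 0 < s) (hs1 : 1 < s)
    (ψ : GelfandShilovWF.GelfandShilov d t s) (hψ : ψ ≠ 0)
    (u : GelfandShilovWF.GelfandShilovDual d t s) :
    ({0} : Set (GelfandShilovWF.E d)) ×ˢ
        (Prod.snd '' GelfandShilovWF.gevreyWaveFrontSet hs (u.toGevrey ht)) ⊆
      GelfandShilovWF.gsWaveFrontSet ht hs ψ u := by
  rintro ⟨_, _⟩ ⟨rfl, ⟨⟨x₀, ξ₀⟩, hmem, rfl⟩⟩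
  by_contra h
  exact GelfandShilovWF.notMem_gevreyWaveFrontSet ht hs hs1 hψ hmem.1 h x₀ hmem

/-- If `t ≥ s > 1` and `u ∈ (Σ_t^s)'(ℝ^d)`, then `{0} × π₂ WF_s(u) ⊆ WF^{t,s}(u)`, the right-hand
side being computed with an arbitrary window `ψ ∈ Σ_t^s(ℝ^d) ∖ 0`. -/
theorem proposition5p1 (d : ℕ) (t s : ℝ) (ht : 0 < t) (hs : 0 < s) (hs1 : 1 < s) (hst : s ≤ t)
    (ψ : GelfandShilovWF.GelfandShilov d t s) (hψ : ψ ≠ 0)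
    (u : GelfandShilovWF.GelfandShilovDual d t s) :
    ({0} : Set (GelfandShilovWF.E d)) ×ˢ
        (Prod.snd '' GelfandShilovWF.gevreyWaveFrontSet hs (u.toGevrey ht)) ⊆
      GelfandShilovWF.gsWaveFrontSet ht hs ψ u :=
  proposition5p1_general d t s ht hs hs1 ψ hψ u
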